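/- Let $n\ge 2$ be an integer, put $$\gamma(p,n)=2+(n+1)p-(n-1)p^2,\qquad p_0(n)=\frac{n+1+\sqrt{n^2+10n-7}}{2(n-1)},$$ where $p_0(n)$ is the positive root of $\gamma(\cdot,n)=0$, and let $1<p<p_0(n)$. Let $f\in H^1(\mathbb R^n)$ and $g\in L^2(\mathbb R^n)$ be real-valued and non-negative, both with compact support, with $g$ not vanishing identically (all in the almost everywhere sense), and let $R\in\mathbb R$. For $\varepsilon>0$ consider the initial value problem $$u_{tt}-\Delta u=|u|^p,\qquad u(x,0)=\varepsilon f(x),\quad u_t(x,0)=\varepsilon g(x).\qquad(*)$$ By a solution of $(*)$ on $[0,T)$, $T>0$, we mean a function $u$ with $(u,u_t)\in C([0,T),H^1(\mathbb R^n)\times L^2(\mathbb R^n))$ ($u_t$ being the derivative of $u$ as an $L^2(\mathbb R^n)$-valued function of $t$), which attains the initial data, satisfies $$\operatorname{supp}(u,u_t)\subset\{(x,t)\in\mathbb R^n\times[0,\infty): |x|\le t+R\},$$ and solves the equation in the sense of distributions on $\mathbb R^n\times(0,T)$: $u$ and $|u|^p$ are locally integrable there, and $\iint u\,(\varphi_{tt}-\Delta\varphi)\,dx\,dt=\iint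 |u|^p\varphi\,dx\,dt$ for all $\varphi\in C_c^\infty(\mathbb R^n\times(0,T))$. Let the lifespan $T(\varepsilon)\in[0,\infty]$ be the supremum of all $T>0$ such that $(*)$ has a solution on $[0,T)$ (and $0$ if there is none). Then there exist constants $\varepsilon_0=\varepsilon_0(f,g,n,p,R)>0$ and $C>0$, with $C$ independent of $\varepsilon$, such that $$T(\varepsilon)\le C\,\varepsilon^{-2p(p-1)/\gamma(p,n)}\qquad\text{for all }0<\varepsilon\le\varepsilon_0 .$$ -/

import Mathlib

open MeasureTheory Set Filter Topology

open scoped ENNReal ContDiff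

namespace SemilinearWave

/-- The quadratic `γ(p, n) = 2 + (n + 1) p - (n - 1) p²`. -/
noncomputable def gammaExponent (p : ℝ) (n : ℕ) : ℝ :=
  2 + ((n : ℝ) + 1) * p - ((n : ℝ) - 1) * p ^ 2

/-- Strauss' exponent `p₀(n)`, the positive root of `γ(·, n)`, for `n ≥ 2`. -/
noncomputable def straussExponent (n : ℕ) : ℝ :=
  ((n : ℝ) + 1 + Real.sqrt ((n : ℝ) ^ 2 + 10 * (n : ℝ) - 7)) / (2 * ((n : ℝ) - 1))

/-- `w` is the weak (distributional) gradient of `h` on `ℝⁿ`: for all test functions `φ`,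
`∫ h ∇φ = - ∫ φ w`. -/
def IsWeakGradient {n : ℕ} (h : EuclideanSpace ℝ (Fin n) → ℝ)
    (w : EuclideanSpace ℝ (Fin n) → EuclideanSpace ℝ (Fin n)) : Prop :=
  LocallyIntegrable h ∧ LocallyIntegrable w ∧
    ∀ φ : EuclideanSpace ℝ (Fin n) → ℝ, ContDiff ℝ ∞ φ → HasCompactSupport φ →
      ∫ x, h x • gradient φ x = - ∫ x, φ x • w x

/-- Membership in the Sobolev space `H¹(ℝⁿ)`. -/
def MemH1 {n : ℕ} (h : EuclideanSpace ℝ (Fin n) → ℝ) : Prop :=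
  MemLp h 2 ∧ ∃ w : EuclideanSpace ℝ (Fin n) → EuclideanSpace ℝ (Fin n),
    IsWeakGradient h w ∧ MemLp w 2

/-- `t ↦ h t` is a continuous curve `[0, T) → L²(ℝⁿ; F)`. -/
def ContinuousL2 {n : ℕ} {F : Type} [NormedAddCommGroup F] (T : ℝ)
    (h : ℝ → EuclideanSpace ℝ (Fin n) → F) : Prop :=
  (∀ t ∈ Ico 0 T, MemLp (h t) 2) ∧
    ∀ t ∈ Ico 0 T, Tendsto (fun s => eLpNorm (h s - h t) 2) (𝓝[Ico 0 T] t) (𝓝 0)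

/-- `t ↦ h t` is a continuous curve `[0, T) → H¹(ℝⁿ)`: it is continuous into `L²`, and so is
the curve of its weak spatial gradients. -/
def ContinuousH1 {n : ℕ} (T : ℝ) (h : ℝ → EuclideanSpace ℝ (Fin n) → ℝ) : Prop :=
  ContinuousL2 T h ∧
    ∃ w : ℝ → EuclideanSpace ℝ (Fin n) → EuclideanSpace ℝ (Fin n),
      (∀ t ∈ Ico 0 T, IsWeakGradient (h t) (w t)) ∧ ContinuousL2 T w

/-- `ut` is the time derivative of the curve `u` on `[0, T)`: the difference quotients converge
in `L²(ℝⁿ)` (one-sided at `t = 0`). -/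
def IsTimeDerivative {n : ℕ} (T : ℝ) (u ut : ℝ → EuclideanSpace ℝ (Fin n) → ℝ) : Prop :=
  ∀ t ∈ Ico 0 T,
    Tendsto (fun s => eLpNorm (fun x => (u s x - u t x) / (s - t) - ut t x) 2)
      (𝓝[Ico 0 T \ {t}] t) (𝓝 0)

/-- `u_tt - Δu = |u|^p` in the sense of distributions on `(0, T) × ℝⁿ`. Here `u` and `|u|^p`
are locally integrable on `(0, T) × ℝⁿ`, so that both are distributions there. -/
def SolvesWeakly {n : ℕ} (p T : ℝ) (u : ℝ → EuclideanSpace ℝ (Fin n) → ℝ) : Prop :=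
  LocallyIntegrableOn (fun z : ℝ × EuclideanSpace ℝ (Fin n) => u z.1 z.2) (Ioo 0 T ×ˢ univ) ∧
  LocallyIntegrableOn (fun z : ℝ × EuclideanSpace ℝ (Fin n) => |u z.1 z.2| ^ p)
    (Ioo 0 T ×ˢ univ) ∧
  ∀ φ : ℝ × EuclideanSpace ℝ (Fin n) → ℝ, ContDiff ℝ ∞ φ → HasCompactSupport φ →
    tsupport φ ⊆ Ioo 0 T ×ˢ univ →
      ∫ z in Ioo 0 T ×ˢ univ, u z.1 z.2 *
          (iteratedDeriv 2 (fun s => φ (s, z.2)) z.1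
            - Laplacian.laplacian (fun y => φ (z.1, y)) z.2)
        = ∫ z in Ioo 0 T ×ˢ univ, |u z.1 z.2| ^ p * φ z

/-- `u`, with time derivative `ut`, is a solution on `[0, T)` of the initial value problem
`u_tt - Δu = |u|^p`, `u(0) = ε f`, `u_t(0) = ε g`, with
`(u, u_t) ∈ C([0, T), H¹(ℝⁿ) × L²(ℝⁿ))` and `supp (u, u_t) ⊆ {|x| ≤ t + R}`. -/
structure IsSolution {n : ℕ} (p : ℝ) (f g : EuclideanSpace ℝ (Fin n) → ℝ) (R ε T : ℝ)
    (u ut : ℝ → EuclideanSpace ℝ (Fin n) → ℝ) : Prop where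
  continuous_u : ContinuousH1 T u
  continuous_ut : ContinuousL2 T ut
  time_derivative : IsTimeDerivative T u ut
  initial_u : ∀ᵐ x, u 0 x = ε * f x
  initial_ut : ∀ᵐ x, ut 0 x = ε * g x
  equation : SolvesWeakly p T u
  support_u : ∀ t ∈ Ico 0 T, ∀ᵐ x, t + R < ‖x‖ → u t x = 0
  support_ut : ∀ t ∈ Ico 0 T, ∀ᵐ x, t + R < ‖x‖ → ut t x = 0

/-- The lifespan `T(ε) ∈ [0, ∞]`: the supremum of all `T > 0` such that the initial value problem
has a solution on `[0, T)`. -/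
noncomputable def lifespan {n : ℕ} (p : ℝ) (f g : EuclideanSpace ℝ (Fin n) → ℝ) (R ε : ℝ) :
    ℝ≥0∞ :=
  ⨆ T ∈ {T : ℝ | 0 < T ∧ ∃ u ut : ℝ → EuclideanSpace ℝ (Fin n) → ℝ,
    IsSolution p f g R ε T u ut}, ENNReal.ofReal T

end SemilinearWave

/-!
Pair the solution with the exponentials `exp (ξ·x)`. The moment `U_ξ(t) = ∫ u(t, x) exp (ξ·x) dx`
satisfies `U_ξ'' = |ξ|² U_ξ + ∫ |u|^p exp (ξ·x) dx`. For `|ξ| = 1`, comparison with `cosh` and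
`sinh` shows that `U_ξ(t)` is at least of order `ε exp t`. Averaging over the sphere bounds from
below, by a multiple of `ε`, the pairing of `u` with `exp (-t) φ`, where
`φ(x) = ∫_{|e| = 1} exp (e·x) de` grows like `|x|^{-(n-1)/2} exp |x|`. Hölder's inequality on
`|x| ≤ t + R` then yields `∫ |u|^p ≥ c ε^p (1 + t)^{(n-1)(1-p/2)}`, while Hölder against `1` yields
`∫ |u|^p ≥ c (t + R)^{-n(p-1)} (∫ u)^p`. As `(∫ u)'' = ∫ |u|^p`, the first bound makes `∫ u` large
and the second, applied repeatedly as `∫ u` doubles, forces blow-up unless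
`ε^{p(p-1)} T^{γ(p,n)/2}` is bounded.
-/

namespace SemilinearWave

theorem integrable_mul_of_tsupport_subset {X : Type*} [TopologicalSpace X] [T2Space X]
    [MeasurableSpace X] [OpensMeasurableSpace X] {μ : Measure X} {φ v : X → ℝ} {s : Set X}
    (hv : LocallyIntegrableOn v s μ) (hφ : Continuous φ) (hφc : HasCompactSupport φ)
    (hφs : tsupport φ ⊆ s) : Integrable (fun x => φ x * v x) μ := by
  rw [← integrableOn_iff_integrable_of_support_subset (s := tsupport φ)
    ((Function.support_mul_subset_left φ v).trans (subset_tsupport φ))]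
  exact (hv.integrableOn_compact_subset hφs hφc).continuousOn_mul hφ.continuousOn hφc

theorem exists_subset_Ioo_of_isCompact {a b : ℝ} {K : Set ℝ} (hK : IsCompact K)
    (hne : K.Nonempty) (hsub : K ⊆ Ioo a b) :
    ∃ a' b', K ⊆ Ioo a' b' ∧ Icc a' b' ⊆ Ioo a b := by
  obtain ⟨a', ha, ha'⟩ := exists_between (hsub (hK.sInf_mem hne)).1
  obtain ⟨b', hb', hb⟩ := exists_between (hsub (hK.sSup_mem hne)).2
  exact ⟨a', b', fun x hx => ⟨ha'.trans_le (csInf_le hK.bddBelow hx),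
    (le_csSup hK.bddAbove hx).trans_lt hb'⟩, Icc_subset_Ioo ha hb⟩

theorem integral_deriv_mul_primitive {a b c : ℝ} {G η : ℝ → ℝ}
    (hG : LocallyIntegrableOn G (Ioo a b)) (hc : c ∈ Ioo a b) (hη : ContDiff ℝ ∞ η)
    (hηc : HasCompactSupport η) (hηs : tsupport η ⊆ Ioo a b) :
    ∫ t, deriv η t * (∫ r in c..t, G r) = -∫ t, η t * G t := by
  obtain ⟨a', b', hK, hsub⟩ := exists_subset_Ioo_of_isCompact (hηc.isCompact.insert c)
    (insert_nonempty _ _) (insert_subset hc hηs)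
  have hcmem : c ∈ Ioo a' b' := hK (mem_insert _ _)
  have hlt : a' < b' := hcmem.1.trans hcmem.2
  have hη0 : ∀ t ∉ Ioo a' b', η t = 0 := fun t ht =>
    image_eq_zero_of_notMem_tsupport fun h => ht (hK (mem_insert_of_mem _ h))
  have hη'0 : ∀ t ∉ Ioo a' b', deriv η t = 0 := fun t ht =>
    image_eq_zero_of_notMem_tsupport fun h =>
      ht (hK (mem_insert_of_mem _ (tsupport_deriv_subset h)))
  have hGi : IntervalIntegrable G volume a' b' :=
    ((hG.integrableOn_compact_subset hsub isCompact_Icc).mono_set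
      (uIcc_of_le hlt.le).subset).intervalIntegrable
  have hmem : c ∈ uIcc a' b' := Icc_subset_uIcc (Ioo_subset_Icc_self hcmem)
  have hηac : AbsolutelyContinuousOnInterval η a' b' :=
    ((hη.of_le (by simp)).locallyLipschitz.locallyLipschitzOn.exists_lipschitzOnWith_of_compact
      isCompact_uIcc).choose_spec.absolutelyContinuousOnInterval
  have restrict : ∀ F : ℝ → ℝ, (∀ t ∉ Ioo a' b', F t = 0) → ∫ t, F t = ∫ t in a'..b', F t := by
    intro F hF
    rw [intervalIntegral.integral_of_le hlt.le, setIntegral_eq_integral_of_forall_compl_eq_zero]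
    exact fun t ht => hF t fun h => ht (Ioo_subset_Ioc_self h)
  have hparts := hηac.integral_mul_deriv_eq_deriv_mul
    (hGi.absolutelyContinuousOnInterval_intervalIntegral hmem)
  rw [hη0 a' (by simp), hη0 b' (by simp)] at hparts
  rw [restrict _ fun t ht => by simp [hη'0 t ht], restrict _ fun t ht => by simp [hη0 t ht],
    ← neg_eq_iff_eq_neg, ← zero_sub]
  simp only [zero_mul, sub_zero] at hparts
  rw [← hparts]
  refine intervalIntegral.integral_congr_ae ?_
  filter_upwards [hGi.ae_hasDerivAt_integral] with t ht hmem'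
  rw [(ht (uIoc_subset_uIcc hmem') c hmem).deriv]

theorem exists_deriv_eq_of_integral_eq_zero {a b : ℝ} {φ : ℝ → ℝ} (hφ : ContDiff ℝ ∞ φ)
    (hφc : HasCompactSupport φ) (hφs : tsupport φ ⊆ Ioo a b) (hφ0 : ∫ t, φ t = 0) :
    ∃ η : ℝ → ℝ, ContDiff ℝ ∞ η ∧ HasCompactSupport η ∧ tsupport η ⊆ Ioo a b ∧ deriv η = φ := by
  rcases (tsupport φ).eq_empty_or_nonempty with he | hne
  · rw [tsupport_eq_empty_iff] at he
    exact ⟨0, contDiff_const, HasCompactSupport.zero, by simp [tsupport], by simp [he]⟩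
  obtain ⟨a', b', hK, hsub⟩ := exists_subset_Ioo_of_isCompact hφc.isCompact hne hφs
  have hzero : ∀ t ∉ Ioo a' b', φ t = 0 := fun t ht =>
    image_eq_zero_of_notMem_tsupport fun h => ht (hK h)
  have hderiv : ∀ t, HasDerivAt (fun t => ∫ r in a'..t, φ r) (φ t) t := fun t =>
    hφ.continuous.integral_hasStrictDerivAt a' t |>.hasDerivAt
  have hsupp : Function.support (fun t => ∫ r in a'..t, φ r) ⊆ Icc a' b' := by
    intro t ht
    by_contra hmem
    refine ht ?_
    rcases lt_or_ge t a' with hlt | hge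
    · refine intervalIntegral.integral_zero_ae (.of_forall fun r hr => hzero r fun h => ?_)
      rw [uIoc_of_ge hlt.le] at hr
      exact hr.2.not_gt h.1
    · have hbt : b' < t := not_le.1 fun h => hmem ⟨hge, h⟩
      change ∫ r in a'..t, φ r = 0
      rw [intervalIntegral.integral_of_le hge, setIntegral_eq_integral_of_forall_compl_eq_zero,
        hφ0]
      exact fun r hr => hzero r fun h => hr ⟨h.1, (h.2.trans hbt).le⟩
  refine ⟨fun t => ∫ r in a'..t, φ r, ?_, .of_support_subset_isCompact isCompact_Icc hsupp,
    (closure_minimal hsupp isClosed_Icc).trans hsub, funext fun t => (hderiv t).deriv⟩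
  rw [contDiff_infty_iff_deriv]
  exact ⟨fun t => (hderiv t).differentiableAt, by rwa [funext fun t => (hderiv t).deriv]⟩

theorem exists_eq_const_of_integral_deriv_mul_eq_zero {a b : ℝ} {Q : ℝ → ℝ}
    (hQ : ContinuousOn Q (Ioo a b))
    (h : ∀ η : ℝ → ℝ, ContDiff ℝ ∞ η → HasCompactSupport η → tsupport η ⊆ Ioo a b →
      ∫ t, deriv η t * Q t = 0) : ∃ k, EqOn Q (fun _ => k) (Ioo a b) := by
  rcases (Ioo a b).eq_empty_or_nonempty with he | ⟨c, hc⟩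
  · simp [he]
  obtain ⟨ρ, hρs, hρc, hρ, hρ1⟩ : ∃ ρ : ℝ → ℝ, tsupport ρ ⊆ Ioo a b ∧ HasCompactSupport ρ ∧
      ContDiff ℝ ∞ ρ ∧ ∫ t, ρ t = 1 := by
    obtain ⟨r, hr, hball⟩ := Metric.nhds_basis_closedBall.mem_iff.1 (isOpen_Ioo.mem_nhds hc)
    let B : ContDiffBump c := ⟨r / 2, r, half_pos hr, half_lt_self hr⟩
    exact ⟨B.normed volume, by rwa [B.tsupport_normed_eq], B.hasCompactSupport_normed,
      B.contDiff_normed, B.integral_normed⟩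
  have hloc := hQ.locallyIntegrableOn measurableSet_Ioo (μ := volume)
  have hmul {φ : ℝ → ℝ} := integrable_mul_of_tsupport_subset (φ := φ) hloc
  set k := ∫ t, ρ t * Q t
  have hae : ∀ᵐ t, t ∈ Ioo a b → Q t - k = 0 := by
    refine isOpen_Ioo.ae_eq_zero_of_integral_contDiff_smul_eq_zero
      (hloc.sub (continuousOn_const.locallyIntegrableOn measurableSet_Ioo)) fun φ hφ hφc hφs => ?_
    have hφi := hφ.continuous.integrable_of_hasCompactSupport hφc (μ := volume)
    have hρi := hρ.continuous.integrable_of_hasCompactSupport hρc (μ := volume)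
    set m := ∫ t, φ t
    obtain ⟨η, hη, hηc, hηs, hη'⟩ := exists_deriv_eq_of_integral_eq_zero
      (φ := fun t => φ t - m * ρ t) (a := a) (b := b) (hφ.sub (contDiff_const.mul hρ))
      (hφc.sub hρc.mul_left)
      ((tsupport_sub _ _).trans (union_subset hφs ((tsupport_mul_subset_right).trans hρs)))
      (by rw [integral_sub hφi (hρi.const_mul m), integral_const_mul, hρ1, mul_one, sub_self])
    have hzero := h η hη hηc hηs
    simp only [hη', sub_mul, mul_assoc] at hzero
    rw [integral_sub (hmul hφ.continuous hφc hφs) ((hmul hρ.continuous hρc hρs).const_mul m),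
      integral_const_mul] at hzero
    simp only [smul_eq_mul, mul_sub]
    rw [integral_sub (hmul hφ.continuous hφc hφs) (hφi.mul_const k), integral_mul_const]
    exact hzero
  refine ⟨k, Measure.eqOn_open_of_ae_eq (μ := volume) ?_ isOpen_Ioo hQ continuousOn_const⟩
  rw [EventuallyEq, ae_restrict_iff' measurableSet_Ioo]
  filter_upwards [hae] with t ht h using sub_eq_zero.1 (ht h)

theorem continuousOn_primitive_Ioo {a b c : ℝ} {G : ℝ → ℝ}
    (hG : LocallyIntegrableOn G (Ioo a b)) (hc : c ∈ Ioo a b) :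
    ContinuousOn (fun t => ∫ r in c..t, G r) (Ioo a b) := by
  intro t ht
  obtain ⟨a', b', hK, hsub⟩ := exists_subset_Ioo_of_isCompact (isCompact_uIcc (a := c) (b := t))
    nonempty_uIcc (ordConnected_Ioo.uIcc_subset hc ht)
  obtain ⟨hca, htb⟩ : c ∈ Ioo a' b' ∧ t ∈ Ioo a' b' := ⟨hK left_mem_uIcc, hK right_mem_uIcc⟩
  have huIcc : uIcc a' b' = Icc a' b' := uIcc_of_le (hca.1.trans hca.2).le
  have hGi : IntervalIntegrable G volume a' b' :=
    (huIcc ▸ hG.integrableOn_compact_subset hsub isCompact_Icc).intervalIntegrable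
  exact ((intervalIntegral.continuousOn_primitive_interval' hGi
    (huIcc ▸ Ioo_subset_Icc_self hca)).continuousAt
      (huIcc ▸ Icc_mem_nhds htb.1 htb.2)).continuousWithinAt

theorem integral_deriv_mul_eq_neg {a b : ℝ} {U V η : ℝ → ℝ}
    (hU : ∀ t ∈ Ioo a b, HasDerivAt U (V t) t) (hV : ContinuousOn V (Ioo a b))
    (hη : ContDiff ℝ ∞ η) (hηc : HasCompactSupport η) (hηs : tsupport η ⊆ Ioo a b) :
    ∫ t, deriv η t * U t = -∫ t, η t * V t := by
  have hUc : ContinuousOn U (Ioo a b) := fun t ht => (hU t ht).continuousAt.continuousWithinAt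
  have hint {φ v : ℝ → ℝ} (hφ : Continuous φ) (hφc : HasCompactSupport φ)
      (hφs : tsupport φ ⊆ Ioo a b) (hv : ContinuousOn v (Ioo a b)) :=
    integrable_mul_of_tsupport_subset (hv.locallyIntegrableOn (μ := volume) measurableSet_Ioo)
      hφ hφc hφs
  have hi₁ := hint (hη.continuous_deriv (by simp)) hηc.deriv
    (tsupport_deriv_subset.trans hηs) hUc
  have hi₂ := hint hη.continuous hηc hηs hV
  have hderiv : ∀ t, HasDerivAt (fun t => η t * U t) (deriv η t * U t + η t * V t) t := by
    intro t
    by_cases ht : t ∈ tsupport η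
    · exact ((hη.differentiable (by simp)) t).hasDerivAt.mul (hU t (hηs ht))
    · have hη0 : η =ᶠ[𝓝 t] 0 := notMem_tsupport_iff_eventuallyEq.1 ht
      have hzero : (fun t => η t * U t) =ᶠ[𝓝 t] fun _ => 0 := by
        filter_upwards [hη0] with r hr using by simp [hr]
      simpa [hη0.deriv_eq, hη0.eq_of_nhds] using
        (hasDerivAt_const t (0 : ℝ)).congr_of_eventuallyEq hzero
  have hsum := integral_eq_zero_of_hasDerivAt_of_integrable hderiv (hi₁.add hi₂)
    (hint hη.continuous hηc hηs hUc)
  rw [integral_add hi₁ hi₂] at hsum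
  linarith

theorem sub_eq_integral_of_weakDeriv {a b s t : ℝ} {P G : ℝ → ℝ}
    (hP : ContinuousOn P (Ioo a b)) (hG : LocallyIntegrableOn G (Ioo a b))
    (h : ∀ η : ℝ → ℝ, ContDiff ℝ ∞ η → HasCompactSupport η → tsupport η ⊆ Ioo a b →
      ∫ r, deriv η r * P r = -∫ r, η r * G r)
    (hs : s ∈ Ioo a b) (ht : t ∈ Ioo a b) : P t - P s = ∫ r in s..t, G r := by
  have hcont := continuousOn_primitive_Ioo hG hs
  have hGm : ∀ η : ℝ → ℝ, ContDiff ℝ ∞ η → HasCompactSupport η → tsupport η ⊆ Ioo a b →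
      ∫ r, deriv η r * (P r - ∫ x in s..r, G x) = 0 := by
    intro η hη hηc hηs
    have hint {v : ℝ → ℝ} (hv : ContinuousOn v (Ioo a b)) : Integrable fun r => deriv η r * v r :=
      integrable_mul_of_tsupport_subset (hv.locallyIntegrableOn measurableSet_Ioo)
        (hη.continuous_deriv (by simp)) hηc.deriv ((tsupport_deriv_subset).trans hηs)
    simp only [mul_sub]
    rw [integral_sub (hint hP) (hint hcont), h η hη hηc hηs,
      integral_deriv_mul_primitive hG hs hη hηc hηs, sub_self]
  obtain ⟨k, hk⟩ := exists_eq_const_of_integral_deriv_mul_eq_zero (hP.sub hcont) hGm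
  have hks := hk hs
  have hkt := hk ht
  simp only [Pi.sub_apply, intervalIntegral.integral_same, sub_zero] at hks hkt
  linarith

section Slices

variable {X Y : Type*} [TopologicalSpace X] [MeasurableSpace X] [OpensMeasurableSpace X]
  [TopologicalSpace Y] [MeasurableSpace Y] [OpensMeasurableSpace Y]
  [SecondCountableTopology Y] [T2Space Y] [T2Space X]
  {μ : Measure X} {ν : Measure Y} [SFinite μ] [SFinite ν] {v : Y × X → ℝ} {I : Set Y} {K : Set X}

theorem integrable_slice_mul_compact {J : Set Y}
    (hv : LocallyIntegrableOn v (I ×ˢ univ) (ν.prod μ)) (hK : IsCompact K) (hJ : IsCompact J)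
    (hJI : J ⊆ I) {k : X → ℝ} (hk : Continuous k) :
    Integrable (fun z => v z * k z.2) ((ν.restrict J).prod (μ.restrict K)) := by
  rw [Measure.prod_restrict]
  exact (hv.integrableOn_compact_subset (prod_mono hJI (subset_univ K))
    (hJ.prod hK)).mul_continuousOn (hk.comp continuous_snd).continuousOn (hJ.prod hK)

theorem ae_integrable_slice [LocallyCompactSpace Y]
    (hv : LocallyIntegrableOn v (I ×ˢ univ) (ν.prod μ)) (hI : IsOpen I) (hK : IsCompact K)
    (hvK : ∀ t ∈ I, ∀ᵐ x ∂μ, x ∉ K → v (t, x) = 0) :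
    ∀ᵐ t ∂ν, t ∈ I → Integrable (fun x => v (t, x)) μ := by
  refine measure_null_of_locally_null _ fun t ht => ?_
  obtain ⟨htI, -⟩ := Classical.not_imp.1 ht
  obtain ⟨J, hJ, htJ, hJI⟩ := exists_compact_subset hI htI
  have hint :=
    (integrable_slice_mul_compact hv hK hJ hJI (continuous_const (y := 1))).prod_right_ae
  refine ⟨_, inter_mem_nhdsWithin _ (mem_interior_iff_mem_nhds.1 htJ), ?_⟩
  rw [ae_restrict_iff' hJ.measurableSet] at hint
  refine measure_mono_null ?_ (ae_iff.1 hint)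
  rintro s ⟨hs, hsJ⟩ h
  refine (Classical.not_imp.1 hs).2
    (IntegrableOn.integrable_of_ae_notMem_eq_zero ?_ (hvK s (hJI hsJ)))
  simpa only [IntegrableOn, mul_one] using h hsJ

theorem locallyIntegrableOn_integral_slice [LocallyCompactSpace Y]
    (hv : LocallyIntegrableOn v (I ×ˢ univ) (ν.prod μ))
    (hI : IsOpen I) (hK : IsCompact K) (hvK : ∀ t ∈ I, ∀ᵐ x ∂μ, x ∉ K → v (t, x) = 0) {k : X → ℝ}
    (hk : Continuous k) : LocallyIntegrableOn (fun t => ∫ x, v (t, x) * k x ∂μ) I ν := by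
  rw [locallyIntegrableOn_iff hI.isLocallyClosed]
  intro J hJI hJ
  refine (integrable_slice_mul_compact hv hK hJ hJI hk).integral_prod_left.congr ?_
  filter_upwards [ae_restrict_mem hJ.measurableSet] with t ht
  refine setIntegral_eq_integral_of_ae_compl_eq_zero ?_
  filter_upwards [hvK t (hJI ht)] with x hx hxK
  rw [hx hxK, zero_mul]

end Slices

section Tensor

theorem tsupport_tensor_subset {X Y : Type*} [TopologicalSpace X] [TopologicalSpace Y]
    (ζ : Y → ℝ) (θ : X → ℝ) :
    tsupport (fun z : Y × X => ζ z.1 * θ z.2) ⊆ tsupport ζ ×ˢ tsupport θ := by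
  refine closure_minimal (fun z hz => ?_) ((isClosed_tsupport ζ).prod (isClosed_tsupport θ))
  exact ⟨subset_tsupport _ (left_ne_zero_of_mul hz), subset_tsupport _ (right_ne_zero_of_mul hz)⟩

theorem hasCompactSupport_tensor {X Y : Type*} [TopologicalSpace X] [TopologicalSpace Y]
    {ζ : Y → ℝ} {θ : X → ℝ} (hζ : HasCompactSupport ζ) (hθ : HasCompactSupport θ) :
    HasCompactSupport fun z : Y × X => ζ z.1 * θ z.2 :=
  (IsCompact.prod hζ hθ).of_isClosed_subset (isClosed_tsupport _) (tsupport_tensor_subset ζ θ)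

theorem integrable_mul_tensor {X Y : Type*} [TopologicalSpace X] [T2Space X] [TopologicalSpace Y]
    [T2Space Y] [MeasurableSpace (Y × X)] [OpensMeasurableSpace (Y × X)] {μ : Measure (Y × X)}
    {v : Y × X → ℝ} {I : Set Y} (hv : LocallyIntegrableOn v (I ×ˢ univ) μ) {ζ : Y → ℝ} {θ : X → ℝ}
    (hζ : Continuous ζ) (hζc : HasCompactSupport ζ) (hζs : tsupport ζ ⊆ I) (hθ : Continuous θ)
    (hθc : HasCompactSupport θ) : Integrable (fun z => v z * (ζ z.1 * θ z.2)) μ := by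
  have hcont : Continuous fun z : Y × X => ζ z.1 * θ z.2 :=
    (hζ.comp continuous_fst).mul (hθ.comp continuous_snd)
  refine (integrable_mul_of_tsupport_subset hv hcont (hasCompactSupport_tensor hζc hθc)
    ((tsupport_tensor_subset ζ θ).trans (prod_mono hζs (subset_univ _)))).congr ?_
  exact .of_forall fun z => mul_comm _ _

end Tensor

section WeakForm

variable {E : Type*} [NormedAddCommGroup E] [InnerProductSpace ℝ E] [FiniteDimensional ℝ E]

theorem continuous_laplacian {θ : E → ℝ} (hθ : ContDiff ℝ 2 θ) :
    Continuous (Laplacian.laplacian θ) := by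
  rw [InnerProductSpace.laplacian_eq_iteratedFDeriv_stdOrthonormalBasis]
  exact continuous_finsetSum _ fun i _ =>
    (ContinuousMultilinearMap.apply ℝ (fun _ : Fin 2 => E) ℝ _).continuous.comp
      (hθ.continuous_iteratedFDeriv le_rfl)

theorem laplacian_exp_inner (ξ x : E) :
    Laplacian.laplacian (fun y : E => Real.exp (inner ℝ ξ y)) x
      = ‖ξ‖ ^ 2 * Real.exp (inner ℝ ξ x) := by
  have hexp : ∀ y : E, HasFDerivAt (fun y : E => Real.exp (inner ℝ ξ y))
      (Real.exp (inner ℝ ξ y) • innerSL ℝ ξ) y := fun y =>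
    ((innerSL ℝ ξ).hasFDerivAt (x := y)).exp
  have hsecond : ∀ v : E, iteratedFDeriv ℝ 2 (fun y : E => Real.exp (inner ℝ ξ y)) x ![v, v]
      = Real.exp (inner ℝ ξ x) * (inner ℝ ξ v) ^ 2 := by
    intro v
    rw [iteratedFDeriv_two_apply, funext fun y => (hexp y).fderiv,
      ((hexp x).smul_const (innerSL ℝ ξ)).fderiv]
    simp
    ring
  rw [InnerProductSpace.laplacian_eq_iteratedFDeriv_stdOrthonormalBasis]
  simp only [hsecond, ← Finset.mul_sum]
  rw [mul_comm, ← (stdOrthonormalBasis ℝ E).sum_sq_norm_inner_left ξ]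
  simp

theorem tsupport_laplacian_subset (θ : E → ℝ) :
    tsupport (Laplacian.laplacian θ) ⊆ tsupport θ := by
  refine closure_minimal (fun x hx => by_contra fun h => hx ?_) (isClosed_tsupport θ)
  have hzero : θ =ᶠ[𝓝 x] fun _ => 0 := notMem_tsupport_iff_eventuallyEq.1 h
  rw [(InnerProductSpace.laplacian_congr_nhds hzero).eq_of_nhds]
  simp

variable {n : ℕ}

local notation "𝔼" => EuclideanSpace ℝ (Fin n)

theorem SolvesWeakly.tensor {p T : ℝ} {u : ℝ → 𝔼 → ℝ} (hu : SolvesWeakly p T u) {ζ : ℝ → ℝ}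
    (hζ : ContDiff ℝ ∞ ζ) (hζc : HasCompactSupport ζ) (hζs : tsupport ζ ⊆ Ioo 0 T)
    {θ : 𝔼 → ℝ} (hθ : ContDiff ℝ ∞ θ) (hθc : HasCompactSupport θ) :
    ∫ t in Ioo 0 T, ∫ x, u t x * (deriv (deriv ζ) t * θ x - ζ t * Laplacian.laplacian θ x)
      = ∫ t in Ioo 0 T, ∫ x, |u t x| ^ p * (ζ t * θ x) := by
  obtain ⟨hloc, hlocp, hweak⟩ := hu
  have hcont : Continuous (deriv (deriv ζ)) :=
    (contDiff_infty_iff_deriv.1 (contDiff_infty_iff_deriv.1 hζ).2).2.continuous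
  have hsub : tsupport (deriv (deriv ζ)) ⊆ tsupport ζ :=
    tsupport_deriv_subset.trans tsupport_deriv_subset
  have hderiv : ∀ (t : ℝ) (x : 𝔼), iteratedDeriv 2 (fun s => ζ s * θ x) t
      = deriv (deriv ζ) t * θ x := fun t x => by
    simp only [iteratedDeriv_succ, iteratedDeriv_zero, deriv_mul_const_field']
  have hlap : ∀ (t : ℝ) (x : 𝔼), Laplacian.laplacian (fun y => ζ t * θ y) x
      = ζ t * Laplacian.laplacian θ x := fun t x =>
    InnerProductSpace.laplacian_smul (𝕜 := ℝ) (f := θ) (ζ t)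
      (hθ.contDiffAt.of_le (WithTop.coe_le_coe.2 le_top))
  have key := hweak (fun z => ζ z.1 * θ z.2) ((hζ.comp contDiff_fst).mul (hθ.comp contDiff_snd))
    (hasCompactSupport_tensor hζc hθc)
    ((tsupport_tensor_subset ζ θ).trans (prod_mono hζs (subset_univ _)))
  have hint := (integrable_mul_tensor hloc hcont (hζc.of_isClosed_subset (isClosed_tsupport _) hsub)
    (hsub.trans hζs) hθ.continuous hθc).sub
    (integrable_mul_tensor hloc hζ.continuous hζc hζs
      (continuous_laplacian (hθ.of_le (WithTop.coe_le_coe.2 le_top)))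
      (hθc.of_isClosed_subset (isClosed_tsupport _) (tsupport_laplacian_subset θ)))
  have hintp := integrable_mul_tensor hlocp hζ.continuous hζc hζs hθ.continuous hθc
  simp only [← mul_sub, Pi.sub_def] at hint
  simp only [hderiv, hlap] at key
  rw [Measure.volume_eq_prod] at key hint hintp
  rw [setIntegral_prod _ hint.integrableOn, setIntegral_prod _ hintp.integrableOn] at key
  simpa only [Measure.restrict_univ] using key

/-- The pairing `∫ v(x) exp ⟪ξ, x⟫ dx` of `v` with the exponential of frequency `ξ`, an
eigenfunction of the Laplacian for the eigenvalue `‖ξ‖²`. -/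
noncomputable def expMoment (ξ : 𝔼) (v : 𝔼 → ℝ) : ℝ :=
  ∫ x, v x * Real.exp (inner ℝ ξ x)

theorem SolvesWeakly.expMoment_eq {p T r : ℝ} (hp : p ≠ 0) {u : ℝ → 𝔼 → ℝ}
    (hu : SolvesWeakly p T u) (hsupp : ∀ t ∈ Ioo 0 T, ∀ᵐ x, r < ‖x‖ → u t x = 0)
    {ζ : ℝ → ℝ} (hζ : ContDiff ℝ ∞ ζ) (hζc : HasCompactSupport ζ) (hζs : tsupport ζ ⊆ Ioo 0 T)
    (ξ : 𝔼) :
    ∫ t in Ioo 0 T, (deriv (deriv ζ) t - ‖ξ‖ ^ 2 * ζ t) * expMoment ξ (u t)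
      = ∫ t in Ioo 0 T, ζ t * expMoment ξ fun x => |u t x| ^ p := by
  let χ : ContDiffBump (0 : 𝔼) := ⟨max r 0 + 1, max r 0 + 2, by positivity, by linarith⟩
  set θ : 𝔼 → ℝ := fun x => χ x * Real.exp (inner ℝ ξ x) with hθdef
  have hθ : ContDiff ℝ ∞ θ := χ.contDiff.mul
    (Real.contDiff_exp.comp (contDiff_const.inner ℝ contDiff_id))
  have hθ_eq : ∀ x : 𝔼, ‖x‖ ≤ r → θ =ᶠ[𝓝 x] fun y => Real.exp (inner ℝ ξ y) := by
    intro x hx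
    have hmem : x ∈ Metric.ball (0 : 𝔼) χ.rIn := by
      rw [mem_ball_zero_iff]
      exact (hx.trans (le_max_left r 0)).trans_lt (lt_add_one _)
    filter_upwards [χ.eventuallyEq_one_of_mem_ball hmem] with y hy
    simp [hθdef, hy]
  have key := hu.tensor hζ hζc hζs hθ χ.hasCompactSupport.mul_right
  refine (setIntegral_congr_fun measurableSet_Ioo fun t ht => ?_).trans
    (key.trans (setIntegral_congr_fun measurableSet_Ioo fun t ht => ?_))
  · simp only [expMoment, ← integral_const_mul]
    refine integral_congr_ae ?_
    filter_upwards [hsupp t ht] with x hx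
    rcases le_or_gt ‖x‖ r with h | h
    · rw [(hθ_eq x h).eq_of_nhds,
        (InnerProductSpace.laplacian_congr_nhds (hθ_eq x h)).eq_of_nhds, laplacian_exp_inner]
      ring
    · simp [hx h]
  · simp only [expMoment, ← integral_const_mul]
    refine integral_congr_ae ?_
    filter_upwards [hsupp t ht] with x hx
    rcases le_or_gt ‖x‖ r with h | h
    · rw [(hθ_eq x h).eq_of_nhds]
      ring
    · simp [hx h, hp]

end WeakForm

section L2

theorem integral_mul_sub {α : Type*} [MeasurableSpace α] {μ : Measure α} {v w k : α → ℝ}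
    (hv : MemLp v 2 μ) (hw : MemLp w 2 μ) (hk : MemLp k 2 μ) :
    ∫ x, (v x - w x) * k x ∂μ = ∫ x, v x * k x ∂μ - ∫ x, w x * k x ∂μ := by
  simp only [sub_mul]
  exact integral_sub (hv.integrable_mul hk) (hw.integrable_mul hk)

theorem tendsto_integral_mul_of_eLpNorm {α ι : Type*} [MeasurableSpace α] {μ : Measure α}
    {l : Filter ι} {h : ι → α → ℝ} {k : α → ℝ} (hh : ∀ᶠ s in l, AEStronglyMeasurable (h s) μ)
    (hk : MemLp k 2 μ) (hlim : Tendsto (fun s => eLpNorm (h s) 2 μ) l (𝓝 0)) :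
    Tendsto (fun s => ∫ x, h s x * k x ∂μ) l (𝓝 0) := by
  rw [tendsto_zero_iff_enorm_tendsto_zero]
  have hprod : Tendsto (fun s => eLpNorm (h s) 2 μ * eLpNorm k 2 μ) l (𝓝 0) := by
    simpa using ENNReal.Tendsto.mul_const hlim (Or.inr hk.2.ne) (b := eLpNorm k 2 μ)
  refine tendsto_of_tendsto_of_tendsto_of_le_of_le' tendsto_const_nhds hprod
    (.of_forall fun _ => zero_le) ?_
  filter_upwards [hh] with s hs
  calc ‖∫ x, h s x * k x ∂μ‖ₑ ≤ ∫⁻ x, ‖h s x * k x‖ₑ ∂μ := enorm_integral_le_lintegral_enorm _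
    _ = eLpNorm (h s • k) 1 μ := by rw [eLpNorm_one_eq_lintegral_enorm]; rfl
    _ ≤ eLpNorm (h s) 2 μ * eLpNorm k 2 μ := eLpNorm_smul_le_mul_eLpNorm hk.1 hs

variable {n : ℕ}

local notation "𝔼" => EuclideanSpace ℝ (Fin n)

theorem ContinuousL2.continuousOn_integral_mul {T : ℝ} {v : ℝ → 𝔼 → ℝ} {k : 𝔼 → ℝ}
    (hv : ContinuousL2 T v) (hk : MemLp k 2) :
    ContinuousOn (fun t => ∫ x, v t x * k x) (Ico 0 T) := by
  intro t ht
  rw [ContinuousWithinAt, ← tendsto_sub_nhds_zero_iff]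
  refine (tendsto_integral_mul_of_eLpNorm ?_ hk (hv.2 t ht)).congr' ?_
  · filter_upwards [self_mem_nhdsWithin] with s hs using (hv.1 s hs).1.sub (hv.1 t ht).1
  · filter_upwards [self_mem_nhdsWithin] with s hs using
      integral_mul_sub (hv.1 s hs) (hv.1 t ht) hk

theorem IsTimeDerivative.hasDerivWithinAt_integral_mul {T : ℝ} {u ut : ℝ → 𝔼 → ℝ} {k : 𝔼 → ℝ}
    (h : IsTimeDerivative T u ut) (hu : ∀ t ∈ Ico 0 T, MemLp (u t) 2)
    (hut : ∀ t ∈ Ico 0 T, MemLp (ut t) 2) (hk : MemLp k 2) {t : ℝ} (ht : t ∈ Ico 0 T) :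
    HasDerivWithinAt (fun t => ∫ x, u t x * k x) (∫ x, ut t x * k x) (Ico 0 T) t := by
  have hquot : ∀ s ∈ Ico 0 T, MemLp (fun x => (u s x - u t x) / (s - t)) 2 := fun s hs => by
    simpa only [div_eq_inv_mul, Pi.sub_apply] using ((hu s hs).sub (hu t ht)).const_mul (s - t)⁻¹
  rw [hasDerivWithinAt_iff_tendsto_slope, ← tendsto_sub_nhds_zero_iff]
  refine (tendsto_integral_mul_of_eLpNorm ?_ hk (h t ht)).congr' ?_
  · filter_upwards [self_mem_nhdsWithin] with s hs using (hquot s hs.1).1.sub (hut t ht).1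
  · filter_upwards [self_mem_nhdsWithin] with s hs
    rw [integral_mul_sub (hquot s hs.1) (hut t ht) hk, slope_def_field,
      ← integral_mul_sub (hu s hs.1) (hu t ht) hk, ← integral_div]
    simp only [div_mul_eq_mul_div]

end L2

section SecondPrimitive

theorem exp_mul_le_of_mul_le_deriv {a b k : ℝ} {W W' : ℝ → ℝ} (hW : ContinuousOn W (Icc a b))
    (hW' : ∀ t ∈ Ioo a b, HasDerivAt W (W' t) t) (h : ∀ t ∈ Ioo a b, k * W t ≤ W' t) :
    ∀ t ∈ Icc a b, Real.exp (k * (t - a)) * W a ≤ W t := by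
  intro t ht
  have hexp (r : ℝ) : HasDerivAt (fun r => Real.exp (-k * (r - a)))
      (Real.exp (-k * (r - a)) * -k) r := by
    simpa using (((hasDerivAt_id r).sub_const a).const_mul (-k)).exp
  have hmono : MonotoneOn (fun r => Real.exp (-k * (r - a)) * W r) (Icc a b) := by
    refine monotoneOn_of_hasDerivWithinAt_nonneg (convex_Icc a b) (by fun_prop)
      (f' := fun r => Real.exp (-k * (r - a)) * (W' r - k * W r)) ?_ ?_ <;>
      rw [interior_Icc] <;> intro r hr
    · exact (((hexp r).mul (hW' r hr)).congr_deriv (by ring)).hasDerivWithinAt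
    · exact mul_nonneg (Real.exp_pos _).le (sub_nonneg.2 (h r hr))
  have h := hmono (left_mem_Icc.2 (ht.1.trans ht.2)) ht ht.1
  simp only [sub_self, mul_zero, Real.exp_zero, one_mul] at h
  calc Real.exp (k * (t - a)) * W a
      ≤ Real.exp (k * (t - a)) * (Real.exp (-k * (t - a)) * W t) := by gcongr
    _ = W t := by rw [← mul_assoc, ← Real.exp_add]; simp

/-- `U'' = G` on `(a, b)`, where `U' = V` is the classical derivative and `V` is an integral of the
locally integrable function `G`. -/
structure IsSecondPrimitive (a b : ℝ) (U V G : ℝ → ℝ) : Prop where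
  hasDerivAt : ∀ t ∈ Ioo a b, HasDerivAt U (V t) t
  locallyIntegrableOn : LocallyIntegrableOn G (Ioo a b)
  sub_eq_integral : ∀ s ∈ Ioo a b, ∀ t ∈ Ioo a b, V t - V s = ∫ r in s..t, G r

theorem sqrt_div_mul_two_pow_mul_rpow {Y : ℝ} (hY : 0 ≤ Y) (c Λ q : ℝ) (k : ℕ) :
    √(c / (Λ * (2 ^ k * Y) ^ q)) = √(c / (Λ * Y ^ q)) * (2 ^ (-(q / 2))) ^ k := by
  have hsq : ((2 : ℝ) ^ (-(q / 2))) ^ 2 = (2 ^ q)⁻¹ := by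
    rw [← Real.rpow_natCast, ← Real.rpow_mul two_pos.le, ← Real.rpow_neg two_pos.le]
    congr 1
    push_cast
    ring
  rw [← Real.sqrt_sq (by positivity : 0 ≤ ((2 : ℝ) ^ (-(q / 2))) ^ k),
    ← Real.sqrt_mul' _ (by positivity), pow_right_comm, hsq, Real.mul_rpow (by positivity) hY,
    ← Real.rpow_pow_comm two_pos.le]
  congr 1
  simp only [div_eq_mul_inv, mul_inv, inv_pow]
  ring

namespace IsSecondPrimitive

variable {a b s t : ℝ} {U V G : ℝ → ℝ}

theorem continuousOn (h : IsSecondPrimitive a b U V G) : ContinuousOn U (Ioo a b) :=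
  fun t ht => (h.hasDerivAt t ht).continuousAt.continuousWithinAt

theorem integral_le_sub (h : IsSecondPrimitive a b U V G) (hs : s ∈ Ioo a b) (ht : t ∈ Ioo a b)
    (hst : s ≤ t) {F : ℝ → ℝ} (hF : ContinuousOn F (Icc s t))
    (hFG : ∀ᵐ r, r ∈ Icc s t → F r ≤ G r) : ∫ r in s..t, F r ≤ V t - V s := by
  rw [h.sub_eq_integral s hs t ht]
  refine intervalIntegral.integral_mono_ae_restrict hst (uIcc_of_le hst ▸ hF).intervalIntegrable
    ?_ ((ae_restrict_iff' measurableSet_Icc).2 hFG)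
  exact (uIcc_of_le hst ▸ h.locallyIntegrableOn.integrableOn_compact_subset
    (Icc_subset_Ioo hs.1 ht.2) isCompact_Icc).intervalIntegrable

theorem deriv_mono (h : IsSecondPrimitive a b U V G) (hs : s ∈ Ioo a b) (ht : t ∈ Ioo a b)
    (hst : s ≤ t) (hG : ∀ᵐ r, r ∈ Icc s t → 0 ≤ G r) : V s ≤ V t := by
  simpa using h.integral_le_sub hs ht hst continuousOn_const hG

theorem hasDerivAt_integral (h : IsSecondPrimitive a b U V G) (hs : s ∈ Ioo a b)
    (ht : t ∈ Ioo a b) : HasDerivAt (fun r => ∫ x in s..r, U x) (U t) t :=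
  intervalIntegral.integral_hasDerivAt_right
    (h.continuousOn.mono (ordConnected_Ioo.uIcc_subset hs ht)).intervalIntegrable
    (h.continuousOn.stronglyMeasurableAtFilter isOpen_Ioo t ht)
    (h.hasDerivAt t ht).continuousAt

/-- Factor `d² - 1 = (d - 1) (d + 1)`. As `V` need not be differentiable, the argument runs on
`U + Z`, where `Z ≤ V` is the primitive of `U` that agrees with `V` at `s`. -/
theorem exp_mul_add_le (h : IsSecondPrimitive a b U V G) (hs : s ∈ Ioo a b) (ht : t ∈ Ioo a b)
    (hst : s ≤ t) (hUG : ∀ᵐ r, r ∈ Icc s t → U r ≤ G r) :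
    Real.exp (t - s) * (U s + V s) ≤ U t + V t := by
  have hsub : Icc s t ⊆ Ioo a b := Icc_subset_Ioo hs.1 ht.2
  have hU : ContinuousOn U (Icc s t) := h.continuousOn.mono hsub
  set Z : ℝ → ℝ := fun r => V s + ∫ x in s..r, U x with hZ
  have hZV : ∀ r ∈ Icc s t, Z r ≤ V r := fun r hr => by
    have := h.integral_le_sub hs (hsub hr) hr.1 (hU.mono (Icc_subset_Icc_right hr.2))
      (hUG.mono fun x hx hxr => hx ⟨hxr.1, hxr.2.trans hr.2⟩)
    simp only [hZ]
    linarith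
  have hZU : ∀ r ∈ Icc s t, HasDerivAt Z (U r) r := fun r hr =>
    (h.hasDerivAt_integral hs (hsub hr)).const_add (V s)
  have hZc : ContinuousOn Z (Icc s t) := fun r hr => (hZU r hr).continuousAt.continuousWithinAt
  have hsum := exp_mul_le_of_mul_le_deriv (k := 1) (hU.add hZc)
    (fun r hr => (h.hasDerivAt r (hsub (Ioo_subset_Icc_self hr))).add
      (hZU r (Ioo_subset_Icc_self hr)))
    (fun r hr => by rw [Pi.add_apply]; linarith [hZV r (Ioo_subset_Icc_self hr)])
    t (right_mem_Icc.2 hst)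
  rw [one_mul, Pi.add_apply, Pi.add_apply, show Z s = V s by simp [hZ]] at hsum
  linarith [hZV t (right_mem_Icc.2 hst)]

theorem cosh_add_sinh_le (h : IsSecondPrimitive a b U V G) (hs : s ∈ Ioo a b) (ht : t ∈ Ioo a b)
    (hst : s ≤ t) (hUG : ∀ᵐ r, r ∈ Icc s t → U r ≤ G r) :
    U s * Real.cosh (t - s) + V s * Real.sinh (t - s) ≤ U t := by
  have hsub : Icc s t ⊆ Ioo a b := Icc_subset_Ioo hs.1 ht.2
  have hU : ContinuousOn U (Icc s t) := h.continuousOn.mono hsub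
  set w : ℝ → ℝ := fun r => U r - (U s * Real.cosh (r - s) + V s * Real.sinh (r - s)) with hw
  have hw' : ∀ r ∈ Ioo s t,
      HasDerivAt w (V r - (U s * Real.sinh (r - s) + V s * Real.cosh (r - s))) r := fun r hr => by
    have hτ : HasDerivAt (fun r => r - s) 1 r := (hasDerivAt_id r).sub_const s
    exact ((h.hasDerivAt r (hsub (Ioo_subset_Icc_self hr))).sub
      ((hτ.cosh.const_mul (U s)).add (hτ.sinh.const_mul (V s)))).congr_deriv (by simp)
  have hw0 := exp_mul_le_of_mul_le_deriv (k := -1) (by fun_prop) hw' (fun r hr => by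
    have hexp := h.exp_mul_add_le hs (hsub (Ioo_subset_Icc_self hr)) hr.1.le
      (hUG.mono fun x hx hxr => hx ⟨hxr.1, hxr.2.trans hr.2.le⟩)
    rw [← Real.cosh_add_sinh] at hexp
    simp only [hw]
    linarith) t (right_mem_Icc.2 hst)
  simpa [hw] using hw0

theorem add_sq_le (h : IsSecondPrimitive a b U V G) (hs : s ∈ Ioo a b) (ht : t ∈ Ioo a b)
    (hst : s ≤ t) (hV : 0 ≤ V s) {m : ℝ} (hm : ∀ᵐ r, r ∈ Icc s t → m ≤ G r) :
    U s + m * (t - s) ^ 2 / 2 ≤ U t := by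
  have hsub : Icc s t ⊆ Ioo a b := Icc_subset_Ioo hs.1 ht.2
  have hVm : ∀ r ∈ Icc s t, m * (r - s) ≤ V r := fun r hr => by
    have := h.integral_le_sub hs (hsub hr) hr.1 continuousOn_const
      (hm.mono fun x hx hxr => hx ⟨hxr.1, hxr.2.trans hr.2⟩)
    rw [intervalIntegral.integral_const, smul_eq_mul, mul_comm] at this
    linarith
  have hquad (r : ℝ) : HasDerivAt (fun r => m * (r - s) ^ 2 / 2) (m * (r - s)) r :=
    (((((hasDerivAt_id' r).sub_const s).pow 2).const_mul m).div_const 2).congr_deriv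
      (by simp; ring)
  have hmono : MonotoneOn (fun r => U r - m * (r - s) ^ 2 / 2) (Icc s t) := by
    have hU := h.continuousOn.mono hsub
    refine monotoneOn_of_hasDerivWithinAt_nonneg (convex_Icc s t) (by fun_prop)
      (f' := fun r => V r - m * (r - s)) ?_ ?_ <;> rw [interior_Icc] <;> intro r hr
    · exact ((h.hasDerivAt r (hsub (Ioo_subset_Icc_self hr))).sub (hquad r)).hasDerivWithinAt
    · exact sub_nonneg.2 (hVm r (Ioo_subset_Icc_self hr))
  have := hmono (left_mem_Icc.2 hst) (right_mem_Icc.2 hst) hst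
  simp only [sub_self] at this
  linarith

variable {p Λ Y : ℝ}

theorem two_mul_le_of_superlinear (h : IsSecondPrimitive a b U V G)
    (hV : ∀ t ∈ Ioo a b, 0 ≤ V t) (hp : 0 ≤ p) (hΛ : 0 < Λ) (hY : 0 < Y) (hs : a < s)
    (hG : ∀ᵐ r, r ∈ Ioo s b → Λ * U r ^ p ≤ G r) (hU : ∀ t ∈ Ico s b, Y ≤ U t) :
    ∀ t ∈ Ico (s + √(2 / (Λ * Y ^ (p - 1)))) b, 2 * Y ≤ U t := by
  intro t ht
  set τ : ℝ := √(2 / (Λ * Y ^ (p - 1))) with hτ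
  have hτ0 : 0 < τ := by positivity
  have hst : s ≤ t := by linarith [ht.1]
  have hs' : s ∈ Ioo a b := ⟨hs, hst.trans_lt ht.2⟩
  have hτ2 : Λ * Y ^ p * τ ^ 2 = 2 * Y := by
    rw [hτ, Real.sq_sqrt (by positivity), show Y ^ p = Y ^ (p - 1) * Y by
      rw [← Real.rpow_add_one hY.ne', sub_add_cancel]]
    field_simp
  have hgrowth := h.add_sq_le hs' ⟨hs.trans_le hst, ht.2⟩ hst (hV s hs') (m := Λ * Y ^ p) (by
    filter_upwards [hG, Measure.ae_ne volume s] with r hr hrs hrt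
    refine le_trans ?_ (hr ⟨hrt.1.lt_of_ne' hrs, hrt.2.trans_lt ht.2⟩)
    have := hU r ⟨hrt.1, hrt.2.trans_lt ht.2⟩
    gcongr)
  calc 2 * Y = Y + Λ * Y ^ p * τ ^ 2 / 2 := by rw [hτ2]; ring
    _ ≤ U s + Λ * Y ^ p * (t - s) ^ 2 / 2 := by
        gcongr
        · exact hU s ⟨le_rfl, hs'.2⟩
        · linarith [ht.1]
    _ ≤ U t := hgrowth

theorem length_le_of_superlinear (h : IsSecondPrimitive a b U V G)
    (hV : ∀ t ∈ Ioo a b, 0 ≤ V t) (hp : 1 < p) (hΛ : 0 < Λ) (hY : 0 < Y) (hs : a < s)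
    (hG : ∀ᵐ r, r ∈ Ioo s b → Λ * U r ^ p ≤ G r) (hU : ∀ t ∈ Ico s b, Y ≤ U t) :
    (b - s) * (1 - 2 ^ (-((p - 1) / 2))) ≤ √(2 / (Λ * Y ^ (p - 1))) := by
  set θ : ℝ := 2 ^ (-((p - 1) / 2)) with hθ
  set τ : ℝ := √(2 / (Λ * Y ^ (p - 1))) with hτ
  have hθ0 : 0 < θ := by positivity
  have hθ1 : θ < 1 := Real.rpow_lt_one_of_one_lt_of_neg one_lt_two (by linarith)
  have hτ0 : 0 < τ := by positivity
  set σ : ℕ → ℝ := fun k => s + τ * ∑ i ∈ Finset.range k, θ ^ i with hσ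
  have hdouble (k : ℕ) : ∀ t ∈ Ico (σ k) b, 2 ^ k * Y ≤ U t := by
    induction k with
    | zero => simpa [hσ] using hU
    | succ k ih =>
      have hsk : s ≤ σ k := le_add_of_nonneg_right (by positivity)
      have := h.two_mul_le_of_superlinear hV (by linarith) hΛ (by positivity : 0 < 2 ^ k * Y)
        (hs.trans_le hsk) (hG.mono fun r hr hrt => hr ⟨hsk.trans_lt hrt.1, hrt.2⟩) ih
      rw [sqrt_div_mul_two_pow_mul_rpow hY.le, ← hτ, ← hθ] at this
      simpa only [hσ, Finset.sum_range_succ, mul_add, add_assoc, pow_succ', mul_assoc] using this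
  by_contra! hlt
  set t : ℝ := s + τ * (1 - θ)⁻¹ with ht
  have htb : t < b := by
    rw [ht, ← div_eq_mul_inv]
    linarith [(div_lt_iff₀ (sub_pos.2 hθ1)).2 hlt]
  have hσt (k : ℕ) : σ k ≤ t := by
    refine add_le_add_right (mul_le_mul_of_nonneg_left ?_ hτ0.le) s
    rw [← tsum_geometric_of_lt_one hθ0.le hθ1]
    exact (summable_geometric_of_lt_one hθ0.le hθ1).sum_le_tsum _ fun i _ => by positivity
  obtain ⟨k, hk⟩ := pow_unbounded_of_one_lt (U t / Y) (one_lt_two (α := ℝ))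
  rw [div_lt_iff₀ hY] at hk
  exact hk.not_ge (hdouble k t ⟨hσt k, htb⟩)

theorem mono (h : IsSecondPrimitive a b U V G) {a' b' : ℝ} (hsub : Ioo a' b' ⊆ Ioo a b) :
    IsSecondPrimitive a' b' U V G where
  hasDerivAt t ht := h.hasDerivAt t (hsub ht)
  locallyIntegrableOn := h.locallyIntegrableOn.mono_set hsub
  sub_eq_integral s hs t ht := h.sub_eq_integral s (hsub hs) t (hsub ht)

variable {m T₀ : ℝ}

theorem sq_mul_rpow_le_two (h : IsSecondPrimitive 0 (4 * T₀) U V G)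
    (hV : ∀ t ∈ Ioo 0 (4 * T₀), 0 ≤ V t) (hU : ∀ t ∈ Ioo 0 (4 * T₀), 0 ≤ U t) (hT₀ : 0 < T₀)
    (hp : 1 < p) (hm : 0 < m) (hΛ : 0 < Λ) (hmG : ∀ᵐ r, r ∈ Ico T₀ (4 * T₀) → m ≤ G r)
    (hUG : ∀ᵐ r, r ∈ Ico T₀ (4 * T₀) → Λ * U r ^ p ≤ G r) :
    (2 * T₀ * (1 - 2 ^ (-((p - 1) / 2)))) ^ 2 * (Λ * (m * T₀ ^ 2 / 2) ^ (p - 1)) ≤ 2 := by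
  have hlow : ∀ t ∈ Ico (2 * T₀) (4 * T₀), m * T₀ ^ 2 / 2 ≤ U t := by
    intro t ht
    have hT₀' : T₀ ∈ Ioo 0 (4 * T₀) := ⟨hT₀, by linarith⟩
    have hgrowth := h.add_sq_le hT₀' ⟨by linarith [ht.1], ht.2⟩ (by linarith [ht.1]) (hV T₀ hT₀')
      (hmG.mono fun r hr hrt => hr ⟨hrt.1, hrt.2.trans_lt ht.2⟩)
    calc m * T₀ ^ 2 / 2 ≤ 0 + m * (t - T₀) ^ 2 / 2 := by
          rw [zero_add]
          gcongr
          linarith [ht.1]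
      _ ≤ U T₀ + m * (t - T₀) ^ 2 / 2 := by gcongr; exact hU T₀ hT₀'
      _ ≤ U t := hgrowth
  have hlen := h.length_le_of_superlinear hV hp hΛ (by positivity) (by linarith : 0 < 2 * T₀)
    (hUG.mono fun r hr hrt => hr ⟨by linarith [hrt.1], hrt.2⟩) hlow
  have hθ : (2 : ℝ) ^ (-((p - 1) / 2)) < 1 :=
    Real.rpow_lt_one_of_one_lt_of_neg one_lt_two (by linarith)
  rw [← le_div_iff₀ (by positivity)]
  refine (Real.le_sqrt' (mul_pos (by positivity) (sub_pos.2 hθ))).1 ?_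
  rwa [show 4 * T₀ - 2 * T₀ = 2 * T₀ by ring] at hlen

end IsSecondPrimitive

theorem min_one_rpow_mul_rpow_le {b x y β : ℝ} (hx : 0 < x) (hxy : x ≤ y) (hyx : y ≤ b * x) :
    min 1 (b ^ β) * x ^ β ≤ y ^ β := by
  have hb : 0 ≤ b := ((pos_iff_pos_of_mul_pos (hx.trans_le (hxy.trans hyx))).2 hx).le
  rcases le_total 0 β with hβ | hβ
  · calc min 1 (b ^ β) * x ^ β ≤ 1 * x ^ β := by gcongr; exact min_le_left _ _
      _ ≤ y ^ β := by rw [one_mul]; gcongr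
  · calc min 1 (b ^ β) * x ^ β ≤ b ^ β * x ^ β := by gcongr; exact min_le_right _ _
      _ = (b * x) ^ β := (Real.mul_rpow hb hx.le).symm
      _ ≤ y ^ β := Real.rpow_le_rpow_of_nonpos (hx.trans_le hxy) hyx hβ

theorem rpow_mul_rpow_scaling {A x : ℝ} (hx : 0 < x) (hA : 0 ≤ A) (β ν q : ℝ) :
    x ^ (-ν) * (A * x ^ β * x ^ 2) ^ q * x ^ 2 = A ^ q * x ^ ((β + 2) * q - ν + 2) := by
  rw [mul_assoc A, ← Real.rpow_two, ← Real.rpow_add hx, Real.mul_rpow hA (by positivity),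
    ← Real.rpow_mul hx.le, sub_eq_add_neg, Real.rpow_add hx, Real.rpow_add hx]
  ring

/-- Kato's lemma: `A` measures the size of the data, and `K` does not depend on it. -/
theorem exists_kato_constant {p β ν R c₁ c₂ : ℝ} (hp : 1 < p) (hν : 0 ≤ ν) (hR : 0 ≤ R)
    (hc₁ : 0 < c₁) (hc₂ : 0 < c₂) :
    ∃ K : ℝ, ∀ (A T T₀ : ℝ) (U V G : ℝ → ℝ), 0 < A → 1 ≤ T₀ → 4 * T₀ ≤ T →
      IsSecondPrimitive 0 T U V G → (∀ t ∈ Ioo 0 T, 0 ≤ V t) → (∀ t ∈ Ioo 0 T, 0 ≤ U t) →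
      (∀ᵐ t, t ∈ Ico 1 T → c₁ * A * (1 + t) ^ β ≤ G t) →
      (∀ᵐ t, t ∈ Ico 1 T → c₂ * (t + R) ^ (-ν) * U t ^ p ≤ G t) →
      A ^ (p - 1) * T₀ ^ ((β + 2) * (p - 1) - ν + 2) ≤ K := by
  set κ : ℝ := min 1 (5 ^ β)
  set θ : ℝ := 2 ^ (-((p - 1) / 2))
  have hθ1 : 0 < 1 - θ :=
    sub_pos.2 (Real.rpow_lt_one_of_one_lt_of_neg one_lt_two (by linarith))
  set K₀ : ℝ := c₂ * (4 + R) ^ (-ν) * (c₁ * κ / 2) ^ (p - 1) with hK₀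
  refine ⟨2 / ((2 * (1 - θ)) ^ 2 * K₀), ?_⟩
  intro A T T₀ U V G hA hT₀ hT h hV hU hdata hmean
  have hT₀0 : 0 < T₀ := by linarith
  have hsub : Ioo 0 (4 * T₀) ⊆ Ioo 0 T := Ioo_subset_Ioo_right hT
  have hbound := (h.mono hsub).sq_mul_rpow_le_two (m := c₁ * A * (κ * T₀ ^ β))
    (Λ := c₂ * ((4 + R) * T₀) ^ (-ν)) (fun t ht => hV t (hsub ht)) (fun t ht => hU t (hsub ht))
    hT₀0 hp (by positivity) (by positivity)
    (hdata.mono fun r hr hrt => le_trans (mul_le_mul_of_nonneg_left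
      (min_one_rpow_mul_rpow_le hT₀0 (by linarith [hrt.1]) (by linarith [hrt.1, hrt.2]))
        (by positivity)) (hr ⟨hT₀.trans hrt.1, hrt.2.trans_le hT⟩))
    (hmean.mono fun r hr hrt => le_trans (by
      have hr0 : 0 < r := by linarith [hrt.1]
      have := hU r ⟨hr0, hrt.2.trans_le hT⟩
      have : ((4 + R) * T₀) ^ (-ν) ≤ (r + R) ^ (-ν) :=
        Real.rpow_le_rpow_of_nonpos (by linarith) (by nlinarith [hrt.2]) (by linarith)
      gcongr) (hr ⟨hT₀.trans hrt.1, hrt.2.trans_le hT⟩))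
  rw [le_div_iff₀ (by positivity)]
  refine le_of_eq_of_le ?_ hbound
  rw [← rpow_mul_rpow_scaling hT₀0 hA.le, hK₀,
    show c₁ * A * (κ * T₀ ^ β) * T₀ ^ 2 / 2 = c₁ * κ / 2 * (A * T₀ ^ β * T₀ ^ 2) by ring,
    Real.mul_rpow (by positivity : 0 ≤ 4 + R) hT₀0.le,
    Real.mul_rpow (by positivity : 0 ≤ c₁ * κ / 2) (by positivity)]
  ring

end SecondPrimitive

section Moments

variable {n : ℕ} {p R ε T : ℝ}

local notation "𝔼" => EuclideanSpace ℝ (Fin n)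

variable {f g : EuclideanSpace ℝ (Fin n) → ℝ} {u ut : ℝ → EuclideanSpace ℝ (Fin n) → ℝ}

theorem expMoment_eq_integral_indicator {r : ℝ} {v : 𝔼 → ℝ} (hv : ∀ᵐ x, r < ‖x‖ → v x = 0)
    (ξ : 𝔼) : expMoment ξ v =
      ∫ x, v x * (Metric.closedBall (0 : 𝔼) r).indicator (fun x => Real.exp (inner ℝ ξ x)) x := by
  refine integral_congr_ae ?_
  filter_upwards [hv] with x hx
  rcases le_or_gt ‖x‖ r with h | h
  · rw [indicator_of_mem (mem_closedBall_zero_iff.2 h)]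
  · simp [hx h]

theorem memLp_indicator_exp_inner (r : ℝ) (ξ : 𝔼) (q : ℝ≥0∞) :
    MemLp ((Metric.closedBall (0 : 𝔼) r).indicator fun x => Real.exp (inner ℝ ξ x)) q := by
  have hball := isCompact_closedBall (0 : 𝔼) r
  have : IsFiniteMeasure (volume.restrict (Metric.closedBall (0 : 𝔼) r)) :=
    ⟨by simpa using hball.measure_lt_top⟩
  have hcont : Continuous fun x : 𝔼 => Real.exp (inner ℝ ξ x) := by fun_prop
  obtain ⟨M, hM⟩ := hball.exists_bound_of_continuousOn hcont.continuousOn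
  rw [memLp_indicator_iff_restrict hball.measurableSet]
  exact .of_bound hcont.aestronglyMeasurable M
    ((ae_restrict_iff' hball.measurableSet).2 (.of_forall hM))

namespace IsSolution

theorem ae_eq_zero_u (h : IsSolution p f g R ε T u ut) :
    ∀ t ∈ Ico 0 T, ∀ᵐ x, T + R < ‖x‖ → u t x = 0 := by
  intro t ht
  filter_upwards [h.support_u t ht] with x hx hlt using hx (by linarith [ht.2])

theorem ae_eq_zero_ut (h : IsSolution p f g R ε T u ut) :
    ∀ t ∈ Ico 0 T, ∀ᵐ x, T + R < ‖x‖ → ut t x = 0 := by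
  intro t ht
  filter_upwards [h.support_ut t ht] with x hx hlt using hx (by linarith [ht.2])

theorem continuousOn_expMoment_ut (h : IsSolution p f g R ε T u ut) (ξ : 𝔼) :
    ContinuousOn (fun t => expMoment ξ (ut t)) (Ico 0 T) :=
  (h.continuous_ut.continuousOn_integral_mul (memLp_indicator_exp_inner (T + R) ξ 2)).congr
    fun t ht => expMoment_eq_integral_indicator (h.ae_eq_zero_ut t ht) ξ

theorem hasDerivWithinAt_expMoment (h : IsSolution p f g R ε T u ut) (ξ : 𝔼) {t : ℝ}
    (ht : t ∈ Ico 0 T) :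
    HasDerivWithinAt (fun t => expMoment ξ (u t)) (expMoment ξ (ut t)) (Ico 0 T) t := by
  rw [expMoment_eq_integral_indicator (h.ae_eq_zero_ut t ht) ξ]
  exact (h.time_derivative.hasDerivWithinAt_integral_mul h.continuous_u.1.1 h.continuous_ut.1
    (memLp_indicator_exp_inner (T + R) ξ 2) ht).congr
    (fun s hs => expMoment_eq_integral_indicator (h.ae_eq_zero_u s hs) ξ)
    (expMoment_eq_integral_indicator (h.ae_eq_zero_u t ht) ξ)

theorem continuousOn_expMoment (h : IsSolution p f g R ε T u ut) (ξ : 𝔼) :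
    ContinuousOn (fun t => expMoment ξ (u t)) (Ico 0 T) := fun _ ht =>
  (h.hasDerivWithinAt_expMoment ξ ht).continuousWithinAt

theorem hasDerivAt_expMoment (h : IsSolution p f g R ε T u ut) (ξ : 𝔼) {t : ℝ}
    (ht : t ∈ Ioo 0 T) :
    HasDerivAt (fun t => expMoment ξ (u t)) (expMoment ξ (ut t)) t :=
  (h.hasDerivWithinAt_expMoment ξ (Ioo_subset_Ico_self ht)).hasDerivAt (Ico_mem_nhds ht.1 ht.2)

theorem ae_rpow_eq_zero (h : IsSolution p f g R ε T u ut) (hp : p ≠ 0) :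
    ∀ t ∈ Ioo 0 T, ∀ᵐ x, x ∉ Metric.closedBall (0 : 𝔼) (T + R) → |u t x| ^ p = 0 := by
  intro t ht
  filter_upwards [h.ae_eq_zero_u t (Ioo_subset_Ico_self ht)] with x hx hmem
  rw [mem_closedBall_zero_iff, not_le] at hmem
  simp [hx hmem, hp]

theorem ae_integrable_rpow (h : IsSolution p f g R ε T u ut) (hp : p ≠ 0) :
    ∀ᵐ t, t ∈ Ioo 0 T → Integrable fun x => |u t x| ^ p :=
  ae_integrable_slice (v := fun z => |u z.1 z.2| ^ p) h.equation.2.1 isOpen_Ioo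
    (isCompact_closedBall 0 (T + R)) (h.ae_rpow_eq_zero hp)

theorem locallyIntegrableOn_expMoment_rpow (h : IsSolution p f g R ε T u ut) (hp : p ≠ 0)
    (ξ : 𝔼) : LocallyIntegrableOn (fun t => expMoment ξ fun x => |u t x| ^ p) (Ioo 0 T) :=
  locallyIntegrableOn_integral_slice (v := fun z => |u z.1 z.2| ^ p) h.equation.2.1 isOpen_Ioo
    (isCompact_closedBall 0 (T + R)) (h.ae_rpow_eq_zero hp) (by fun_prop)

theorem integral_deriv_mul_expMoment_ut (h : IsSolution p f g R ε T u ut) (hp : p ≠ 0) (ξ : 𝔼)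
    {η : ℝ → ℝ} (hη : ContDiff ℝ ∞ η) (hηc : HasCompactSupport η) (hηs : tsupport η ⊆ Ioo 0 T) :
    ∫ t, deriv η t * expMoment ξ (ut t) =
      -∫ t, η t * ((expMoment ξ fun x => |u t x| ^ p) + ‖ξ‖ ^ 2 * expMoment ξ (u t)) := by
  have hU := ((h.continuousOn_expMoment ξ).mono Ioo_subset_Ico_self).locallyIntegrableOn
    (μ := volume) measurableSet_Ioo
  have hη' : ContDiff ℝ ∞ (deriv η) := (contDiff_infty_iff_deriv.1 hη).2
  have hη's : tsupport (deriv η) ⊆ Ioo 0 T := tsupport_deriv_subset.trans hηs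
  have hη''s : tsupport (deriv (deriv η)) ⊆ Ioo 0 T := tsupport_deriv_subset.trans hη's
  have hparts := integral_deriv_mul_eq_neg (fun t ht => h.hasDerivAt_expMoment ξ ht)
    ((h.continuousOn_expMoment_ut ξ).mono Ioo_subset_Ico_self) hη' hηc.deriv hη's
  have hweak := h.equation.expMoment_eq hp (fun t ht => h.ae_eq_zero_u t (Ioo_subset_Ico_self ht))
    hη hηc hηs ξ
  have hη0 : ∀ t ∉ Ioo 0 T, η t = 0 := fun t ht =>
    image_eq_zero_of_notMem_tsupport fun h => ht (hηs h)
  have hη''0 : ∀ t ∉ Ioo 0 T, deriv (deriv η) t = 0 := fun t ht =>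
    image_eq_zero_of_notMem_tsupport fun h => ht (hη''s h)
  rw [setIntegral_eq_integral_of_forall_compl_eq_zero (by simp +contextual [hη0, hη''0]),
    setIntegral_eq_integral_of_forall_compl_eq_zero (by simp +contextual [hη0])] at hweak
  have hint₁ := integrable_mul_of_tsupport_subset hU (contDiff_infty_iff_deriv.1 hη').2.continuous
    hηc.deriv.deriv hη''s
  have hint₂ := integrable_mul_of_tsupport_subset hU hη.continuous hηc hηs
  have hint₃ := integrable_mul_of_tsupport_subset (h.locallyIntegrableOn_expMoment_rpow hp ξ)
    hη.continuous hηc hηs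
  simp only [sub_mul, mul_add, mul_assoc, mul_left_comm (η _)] at hweak ⊢
  rw [integral_sub hint₁ (hint₂.const_mul _), integral_const_mul, hparts] at hweak
  rw [integral_add hint₃ (hint₂.const_mul _), integral_const_mul]
  linarith

theorem isSecondPrimitive_expMoment (h : IsSolution p f g R ε T u ut) (hp : p ≠ 0) (ξ : 𝔼) :
    IsSecondPrimitive 0 T (fun t => expMoment ξ (u t)) (fun t => expMoment ξ (ut t))
      fun t => (expMoment ξ fun x => |u t x| ^ p) + ‖ξ‖ ^ 2 * expMoment ξ (u t) where
  hasDerivAt _ ht := h.hasDerivAt_expMoment ξ ht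
  locallyIntegrableOn := (h.locallyIntegrableOn_expMoment_rpow hp ξ).add <|
    (continuousOn_const.mul ((h.continuousOn_expMoment ξ).mono
      Ioo_subset_Ico_self)).locallyIntegrableOn measurableSet_Ioo
  sub_eq_integral _ hs _ ht := sub_eq_integral_of_weakDeriv
    ((h.continuousOn_expMoment_ut ξ).mono Ioo_subset_Ico_self)
    ((h.locallyIntegrableOn_expMoment_rpow hp ξ).add <|
      (continuousOn_const.mul ((h.continuousOn_expMoment ξ).mono
        Ioo_subset_Ico_self)).locallyIntegrableOn measurableSet_Ioo)
    (fun _ hη hηc hηs => h.integral_deriv_mul_expMoment_ut hp ξ hη hηc hηs) hs ht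

end IsSolution

end Moments

section SphereExp

theorem one_add_norm_mul_norm_smul_sub_sq_le {E : Type*} [NormedAddCommGroup E]
    [InnerProductSpace ℝ E] {e : E} (he : ‖e‖ = 1) (x : E) {ρ : ℝ} (hρ : ρ ≤ 2) :
    (1 + ‖x‖) / 4 * ‖ρ • e - ‖x‖⁻¹ • x‖ ^ 2 ≤
      (1 + ‖x‖) * (ρ - 1) ^ 2 / 4 + (2 + ‖x‖ - inner ℝ e x) := by
  set v := ‖x‖⁻¹ • x with hv
  have hv₁ : ‖v‖ ≤ 1 := by
    rw [hv, norm_smul, norm_inv, norm_norm]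
    exact inv_mul_le_one
  have hx : inner ℝ e x = ‖x‖ * inner ℝ e v := by
    rcases eq_or_ne x 0 with rfl | hx
    · simp
    · rw [hv, inner_smul_right, mul_inv_cancel_left₀ (norm_ne_zero_iff.2 hx)]
  have hc : inner ℝ e v ≤ 1 ∧ -1 ≤ inner ℝ e v := (abs_le.1 <|
    (abs_real_inner_le_norm e v).trans (by rwa [he, one_mul] : ‖e‖ * ‖v‖ ≤ 1)).symm
  have hsq : ‖ρ • e - v‖ ^ 2 ≤ (ρ - 1) ^ 2 + 4 * (1 - inner ℝ e v) := by
    rw [norm_sub_sq_real, norm_smul, he, inner_smul_left, Real.norm_eq_abs, mul_one, sq_abs,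
      RCLike.conj_to_real]
    nlinarith [norm_nonneg v, mul_nonneg (sub_nonneg.2 hρ) (sub_nonneg.2 hc.1)]
  rw [hx]
  nlinarith [mul_le_mul_of_nonneg_left hsq (by positivity : 0 ≤ (1 + ‖x‖) / 4)]

theorem exp_inner_le_gaussian {E : Type*} [NormedAddCommGroup E] [InnerProductSpace ℝ E]
    {e : E} (he : ‖e‖ = 1) (x : E) {ρ : ℝ} (hρ : ρ ≤ 2) (hxρ : (1 + ‖x‖) * (ρ - 1) ^ 2 ≤ 1) :
    Real.exp (-(9 / 4 + ‖x‖)) * Real.exp (inner ℝ e x) ≤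
      Real.exp (-((1 + ‖x‖) / 4) * ‖ρ • e - ‖x‖⁻¹ • x‖ ^ 2) := by
  rw [← Real.exp_add]
  exact Real.exp_le_exp.2 (by linarith [one_add_norm_mul_norm_smul_sub_sq_le he x hρ])

variable {E : Type*} [NormedAddCommGroup E] [InnerProductSpace ℝ E] [FiniteDimensional ℝ E]
  [MeasurableSpace E] [BorelSpace E]

local notation "dim" => Module.finrank ℝ

theorem integral_eq_integral_sphere_prod {F : Type*} [NormedAddCommGroup F] [NormedSpace ℝ F]
    [Nontrivial E] (μ : Measure E) [μ.IsAddHaarMeasure] (h : E → F) :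
    ∫ y, h y ∂μ = ∫ z : Metric.sphere (0 : E) 1 × Ioi (0 : ℝ), h ((z.2 : ℝ) • (z.1 : E))
      ∂μ.toSphere.prod (.volumeIoiPow (dim E - 1)) := by
  rw [← μ.measurePreserving_homeomorphUnitSphereProd.integral_comp
    (Homeomorph.measurableEmbedding _)]
  calc ∫ y, h y ∂μ = ∫ y : ({0}ᶜ : Set E), h y ∂μ.comap (↑) := by
        rw [integral_subtype_comap (measurableSet_singleton _).compl, restrict_compl_singleton]
    _ = _ := by
        refine integral_congr_ae (.of_forall fun y => ?_)
        simp [smul_inv_smul₀ (norm_ne_zero_iff.2 y.2)]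

theorem ofReal_le_volumeIoiPow_Ico (k : ℕ) {δ : ℝ} (hδ : 0 < δ) :
    ENNReal.ofReal δ ≤ Measure.volumeIoiPow k
      (Ico ⟨1, mem_Ioi.2 one_pos⟩ ⟨1 + δ, mem_Ioi.2 (add_pos one_pos hδ)⟩) := by
  have hbernoulli : 1 + (k + 1 : ℝ) * δ ≤ (1 + δ) ^ (k + 1) := by
    exact_mod_cast one_add_mul_le_pow (by linarith : (-2 : ℝ) ≤ δ) (k + 1)
  rw [← Iio_sdiff_Iio, measure_sdiff (Iio_subset_Iio (by simp [hδ.le]))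
    measurableSet_Iio.nullMeasurableSet
    (by simp [Measure.volumeIoiPow_apply_Iio]), Measure.volumeIoiPow_apply_Iio,
    Measure.volumeIoiPow_apply_Iio, ← ENNReal.ofReal_sub _ (by positivity)]
  refine ENNReal.ofReal_le_ofReal ?_
  rw [← sub_div, le_div_iff₀ (by positivity)]
  simp only [one_pow]
  linarith

/-- The integral `∫_{|e| = 1} exp (e·x) de` of plane exponentials over the unit sphere. It is a
positive radial solution of `Δφ = φ`, so `exp (-t) φ` solves the wave equation. -/
noncomputable def sphereExp (x : E) : ℝ :=
  ∫ e : Metric.sphere (0 : E) 1, Real.exp (inner ℝ (e : E) x) ∂(volume : Measure E).toSphere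

theorem sphereExp_nonneg (x : E) : 0 ≤ sphereExp x :=
  integral_nonneg fun _ => (Real.exp_pos _).le

theorem continuous_sphereExp : Continuous (sphereExp : E → ℝ) := by
  have h := continuous_parametric_integral_of_continuous (μ := (volume : Measure E).toSphere)
    (f := fun (x : E) (e : Metric.sphere (0 : E) 1) => Real.exp (inner ℝ (e : E) x))
    (by fun_prop) isCompact_univ
  change Continuous fun x : E => sphereExp x
  simpa only [sphereExp, setIntegral_univ] using h

theorem integral_gaussian_sub {b : ℝ} (hb : 0 < b) (v : E) :
    ∫ y : E, Real.exp (-b * ‖y - v‖ ^ 2) = (Real.pi / b) ^ (dim E / 2 : ℝ) :=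
  (integral_sub_right_eq_self (fun y : E => Real.exp (-b * ‖y‖ ^ 2)) v).trans
    (GaussianFourier.integral_rexp_neg_mul_sq_norm hb)

theorem integral_gaussian_sphere_prod [Nontrivial E] {b : ℝ} (hb : 0 < b) (v : E) :
    ∫ z : Metric.sphere (0 : E) 1 × Ioi (0 : ℝ),
      Real.exp (-b * ‖(z.2 : ℝ) • (z.1 : E) - v‖ ^ 2)
        ∂(volume : Measure E).toSphere.prod (.volumeIoiPow (dim E - 1)) =
      (Real.pi / b) ^ (dim E / 2 : ℝ) := by
  rw [← integral_gaussian_sub hb v, integral_eq_integral_sphere_prod volume]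

/-- Compare with the Gaussian `y ↦ exp (-(1 + ‖x‖) ‖y - x / ‖x‖‖² / 4)`, integrated in polar
coordinates over the shell `1 ≤ ‖y‖ < 1 + δ`. -/
theorem sphereExp_mul_le [Nontrivial E] (x : E) {δ : ℝ} (hδ₀ : 0 < δ)
    (hδ : (1 + ‖x‖) * δ ^ 2 ≤ 1) :
    Real.exp (-(9 / 4 + ‖x‖)) * sphereExp x * δ ≤
      (Real.pi / ((1 + ‖x‖) / 4)) ^ (dim E / 2 : ℝ) := by
  have hδ₁ : δ ≤ 1 := by nlinarith [norm_nonneg x, mul_nonneg (norm_nonneg x) (sq_nonneg δ)]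
  set I : Set (Ioi (0 : ℝ)) :=
    Ico ⟨1, mem_Ioi.2 one_pos⟩ ⟨1 + δ, mem_Ioi.2 (add_pos one_pos hδ₀)⟩
  set ν : Measure (Ioi (0 : ℝ)) := .volumeIoiPow (dim E - 1)
  set G : Metric.sphere (0 : E) 1 × Ioi (0 : ℝ) → ℝ := fun z =>
    Real.exp (-((1 + ‖x‖) / 4) * ‖(z.2 : ℝ) • (z.1 : E) - ‖x‖⁻¹ • x‖ ^ 2)
  have hGauss : ∫ z, G z ∂(volume : Measure E).toSphere.prod ν =
      (Real.pi / ((1 + ‖x‖) / 4)) ^ (dim E / 2 : ℝ) :=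
    integral_gaussian_sphere_prod (by positivity) _
  have hGint : Integrable G ((volume : Measure E).toSphere.prod ν) :=
    .of_integral_ne_zero (by rw [hGauss]; positivity)
  have hνI_top : ν I ≠ ⊤ :=
    ((measure_mono Ico_subset_Iio_self).trans_lt (by simp [ν, Measure.volumeIoiPow_apply_Iio])).ne
  have hνI : δ ≤ ν.real I :=
    (ENNReal.ofReal_le_iff_le_toReal hνI_top).1 (ofReal_le_volumeIoiPow_Ico _ hδ₀)
  calc Real.exp (-(9 / 4 + ‖x‖)) * sphereExp x * δ
      ≤ Real.exp (-(9 / 4 + ‖x‖)) * sphereExp x * ν.real I := by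
        have := sphereExp_nonneg x
        gcongr
    _ = ∫ z in univ ×ˢ I, Real.exp (-(9 / 4 + ‖x‖)) * Real.exp (inner ℝ (z.1 : E) x) * 1
          ∂(volume : Measure E).toSphere.prod ν := by
        rw [setIntegral_prod_mul (fun e : Metric.sphere (0 : E) 1 =>
          Real.exp (-(9 / 4 + ‖x‖)) * Real.exp (inner ℝ (e : E) x)) (fun _ => (1 : ℝ)),
          setIntegral_univ, integral_const_mul, setIntegral_const, smul_eq_mul, mul_one, sphereExp]
    _ ≤ ∫ z in univ ×ˢ I, G z ∂(volume : Measure E).toSphere.prod ν := by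
        refine integral_mono_of_nonneg (.of_forall fun z => by positivity) hGint.integrableOn ?_
        filter_upwards [ae_restrict_mem (.prod .univ measurableSet_Ico)]
        rintro ⟨e, ρ, hρ₀⟩ ⟨-, hρ₁ : 1 ≤ ρ, hρ₂ : ρ < 1 + δ⟩
        rw [mul_one]
        exact exp_inner_le_gaussian (norm_eq_of_mem_sphere e) x (by linarith)
          (hδ.trans' (by gcongr; linarith))
    _ ≤ ∫ z, G z ∂(volume : Measure E).toSphere.prod ν :=
        setIntegral_le_integral hGint (.of_forall fun _ => (Real.exp_pos _).le)
    _ = _ := hGauss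

theorem sphereExp_le [Nontrivial E] (x : E) :
    sphereExp x ≤ Real.exp (9 / 4) * (4 * Real.pi) ^ (dim E / 2 : ℝ) *
      (Real.exp ‖x‖ * (1 + ‖x‖) ^ (-((dim E - 1) / 2 : ℝ))) := by
  have hs : 0 < 1 + ‖x‖ := by positivity
  have h := sphereExp_mul_le x (δ := (1 + ‖x‖) ^ (-(1 / 2) : ℝ)) (by positivity) (by
    rw [← Real.rpow_mul_natCast hs.le]; norm_num [Real.rpow_neg_one, hs.ne'])
  rw [show Real.pi / ((1 + ‖x‖) / 4) = 4 * Real.pi / (1 + ‖x‖) by field_simp,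
    Real.div_rpow (by positivity) hs.le, ← le_div_iff₀ (by positivity), Real.exp_neg,
    inv_mul_le_iff₀ (by positivity), Real.exp_add] at h
  refine h.trans_eq ?_
  rw [show -((dim E - 1) / 2 : ℝ) = -(dim E / 2) + 1 / 2 by ring, Real.rpow_add hs,
    Real.rpow_neg hs.le, Real.rpow_neg hs.le]
  field_simp

theorem setIntegral_closedBall_fun_norm [Nontrivial E] (μ : Measure E) [μ.IsAddHaarMeasure] {L : ℝ}
    (hL : 0 ≤ L) (h : ℝ → ℝ) :
    ∫ x in Metric.closedBall (0 : E) L, h ‖x‖ ∂μ =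
      dim E * μ.real (Metric.ball 0 1) * ∫ y in (0 : ℝ)..L, y ^ (dim E - 1) * h y := by
  have hball : ∀ x : E, (Metric.closedBall 0 L).indicator (fun x => h ‖x‖) x
      = (Iic L).indicator h ‖x‖ := fun x => by simp [indicator]
  rw [← integral_indicator Metric.isClosed_closedBall.measurableSet, funext hball,
    integral_fun_norm_addHaar μ, nsmul_eq_mul, smul_eq_mul, mul_assoc,
    intervalIntegral.integral_of_le hL, ← Ioi_inter_Iic,
    ← setIntegral_indicator measurableSet_Iic]
  simp only [smul_eq_mul, indicator_mul_right]

theorem setIntegral_exp_norm_sub_le [Nontrivial E] (μ : Measure E) [μ.IsAddHaarMeasure] {L δ : ℝ}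
    (hL : 0 ≤ L) (hδ : 0 < δ) :
    ∫ x in Metric.closedBall (0 : E) L, Real.exp (-(δ * (L - ‖x‖))) ∂μ ≤
      dim E * μ.real (Metric.ball 0 1) / δ * L ^ (dim E - 1) := by
  have hderiv : ∀ y : ℝ, HasDerivAt (fun y => Real.exp (-(δ * (L - y))) / δ)
      (Real.exp (-(δ * (L - y)))) y := fun y =>
    ((((hasDerivAt_id' y).const_sub L).const_mul δ).fun_neg.exp.div_const δ).congr_deriv
      (by field_simp)
  rw [setIntegral_closedBall_fun_norm μ hL fun r => Real.exp (-(δ * (L - r))), ← mul_one_div,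
    mul_assoc _ (1 / δ)]
  refine mul_le_mul_of_nonneg_left ?_ (by positivity)
  calc ∫ y in (0 : ℝ)..L, y ^ (dim E - 1) * Real.exp (-(δ * (L - y)))
      ≤ ∫ y in (0 : ℝ)..L, L ^ (dim E - 1) * Real.exp (-(δ * (L - y))) := by
        refine intervalIntegral.integral_mono_on hL
          (Continuous.intervalIntegrable (by fun_prop) _ _)
          (Continuous.intervalIntegrable (by fun_prop) _ _) fun y hy => ?_
        gcongr
        exacts [hy.1, hy.2]
    _ = L ^ (dim E - 1) * (1 / δ - Real.exp (-(δ * L)) / δ) := by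
        rw [intervalIntegral.integral_const_mul,
          intervalIntegral.integral_eq_sub_of_hasDerivAt (fun y _ => hderiv y)
            (Continuous.intervalIntegrable (by fun_prop) _ _)]
        simp
    _ ≤ L ^ (dim E - 1) * (1 / δ) := by
        gcongr
        exact sub_le_self _ (by positivity)
    _ = 1 / δ * L ^ (dim E - 1) := mul_comm _ _

theorem one_add_rpow_le_exp {a z : ℝ} (ha : 0 ≤ a) (hz : 0 ≤ z) :
    (1 + z) ^ a ≤ (2 * (a + 1)) ^ a * Real.exp (z / 2) := by
  set w := z / (2 * (a + 1)) with hw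
  have hzw : z = 2 * (a + 1) * w := by rw [hw]; field_simp
  have hw₀ : 0 ≤ w := by positivity
  calc (1 + z) ^ a ≤ (2 * (a + 1) * Real.exp w) ^ a := by
        gcongr
        nlinarith [Real.add_one_le_exp w]
    _ = (2 * (a + 1)) ^ a * Real.exp (w * a) := by
        rw [Real.mul_rpow (by positivity) (by positivity), ← Real.exp_mul]
    _ ≤ (2 * (a + 1)) ^ a * Real.exp (z / 2) := by
        gcongr
        nlinarith

theorem exists_exp_neg_mul_sphereExp_le [Nontrivial E] {R : ℝ} (hR : 0 ≤ R) :
    ∃ C > 0, ∀ t ≥ 0, ∀ x : E, ‖x‖ ≤ t + R → Real.exp (-t) * sphereExp x ≤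
      C * (1 + t) ^ (-((dim E - 1) / 2 : ℝ)) * Real.exp (-((t + R - ‖x‖) / 2)) := by
  set a : ℝ := (dim E - 1) / 2 with ha_def
  have ha : 0 ≤ a := by
    have : (1 : ℝ) ≤ dim E := by exact_mod_cast Module.finrank_pos (R := ℝ) (M := E)
    rw [ha_def]
    linarith
  refine ⟨Real.exp (9 / 4) * (4 * Real.pi) ^ (dim E / 2 : ℝ) * Real.exp R * (2 * (a + 1)) ^ a,
    by positivity, fun t ht x hx => ?_⟩
  set z := t + R - ‖x‖ with hz
  have hz₀ : 0 ≤ z := by linarith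
  have hdecay : (1 + ‖x‖) ^ (-a) ≤
      (1 + t) ^ (-a) * ((2 * (a + 1)) ^ a * Real.exp (z / 2)) := by
    rw [Real.rpow_neg (by positivity), Real.rpow_neg (by positivity),
      inv_le_iff_one_le_mul₀ (by positivity), mul_assoc, le_inv_mul_iff₀ (by positivity), mul_one]
    calc (1 + t) ^ a ≤ ((1 + z) * (1 + ‖x‖)) ^ a := by
          gcongr
          nlinarith [mul_nonneg hz₀ (norm_nonneg x)]
      _ = (1 + z) ^ a * (1 + ‖x‖) ^ a := Real.mul_rpow (by positivity) (by positivity)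
      _ ≤ _ := by
          gcongr
          exact one_add_rpow_le_exp ha hz₀
  have hexp : Real.exp (-t) * Real.exp ‖x‖ * Real.exp (z / 2) =
      Real.exp R * Real.exp (-(z / 2)) := by
    rw [← Real.exp_add, ← Real.exp_add, ← Real.exp_add, hz]
    ring_nf
  calc Real.exp (-t) * sphereExp x
      ≤ Real.exp (-t) * (Real.exp (9 / 4) * (4 * Real.pi) ^ (dim E / 2 : ℝ) *
          (Real.exp ‖x‖ * ((1 + t) ^ (-a) * ((2 * (a + 1)) ^ a * Real.exp (z / 2))))) := by
        gcongr
        exact (sphereExp_le x).trans (by gcongr)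
    _ = _ := by
        linear_combination
          Real.exp (9 / 4) * (4 * Real.pi) ^ (dim E / 2 : ℝ) * (1 + t) ^ (-a) *
            (2 * (a + 1)) ^ a * hexp

theorem exists_integral_sphereExp_rpow_le [Nontrivial E] {q R : ℝ} (hq : 0 < q) (hR : 1 ≤ R) :
    ∃ C > 0, ∀ t ≥ 0, ∫ x in Metric.closedBall (0 : E) (t + R), (Real.exp (-t) * sphereExp x) ^ q ≤
      C * (1 + t) ^ ((dim E - 1 : ℝ) * (1 - q / 2)) := by
  obtain ⟨C, hC, hbound⟩ := exists_exp_neg_mul_sphereExp_le (E := E) (zero_le_one.trans hR)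
  have hd : 0 < dim E := Module.finrank_pos
  set V : ℝ := volume.real (Metric.ball (0 : E) 1)
  have hV : 0 < V := ENNReal.toReal_pos (Metric.measure_ball_pos volume _ one_pos).ne'
    measure_ball_lt_top.ne
  refine ⟨C ^ q * (dim E * V / (q / 2)) * R ^ (dim E - 1), by positivity, fun t ht => ?_⟩
  set D := C ^ q * (1 + t) ^ (-((dim E - 1) / 2 : ℝ) * q) with hD
  calc ∫ x in Metric.closedBall (0 : E) (t + R), (Real.exp (-t) * sphereExp x) ^ q
      ≤ ∫ x in Metric.closedBall (0 : E) (t + R), D * Real.exp (-(q / 2 * (t + R - ‖x‖))) := by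
        refine setIntegral_mono_on ?_ ?_ Metric.isClosed_closedBall.measurableSet fun x hx => ?_
        · exact ((continuous_const.mul continuous_sphereExp).rpow_const
            fun _ => .inr hq.le).continuousOn.integrableOn_compact (isCompact_closedBall _ _)
        · exact ContinuousOn.integrableOn_compact (isCompact_closedBall _ _) (by fun_prop)
        · refine (Real.rpow_le_rpow (mul_nonneg (Real.exp_pos _).le (sphereExp_nonneg x))
            (hbound t ht x (mem_closedBall_zero_iff.1 hx)) hq.le).trans_eq ?_
          rw [Real.mul_rpow (by positivity) (by positivity), Real.mul_rpow hC.le (by positivity),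
            ← Real.rpow_mul (by positivity), ← Real.exp_mul, hD]
          ring_nf
    _ ≤ D * (dim E * V / (q / 2) * (R * (1 + t)) ^ (dim E - 1)) := by
        rw [integral_const_mul]
        gcongr
        refine (setIntegral_exp_norm_sub_le volume (by positivity) (by positivity)).trans ?_
        gcongr
        nlinarith
    _ = _ := by
        rw [hD, mul_pow, show (dim E - 1 : ℝ) * (1 - q / 2) =
          -((dim E - 1) / 2 : ℝ) * q + (dim E - 1 : ℕ) by rw [Nat.cast_pred hd]; ring,
          Real.rpow_add (by positivity), Real.rpow_natCast]
        ring

end SphereExp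

section Hoelder

variable {α : Type*} {m : MeasurableSpace α} {μ : Measure α} {p : ℝ} {v w : α → ℝ}

theorem integral_mul_rpow_le (hp : 1 < p) (hv : MemLp v (ENNReal.ofReal p) μ)
    (hw : MemLp w (ENNReal.ofReal (p / (p - 1))) μ) (hw₀ : 0 ≤ᵐ[μ] w)
    (hvw : 0 ≤ ∫ a, v a * w a ∂μ) :
    (∫ a, v a * w a ∂μ) ^ p ≤ (∫ a, |v a| ^ p ∂μ) * (∫ a, w a ^ (p / (p - 1)) ∂μ) ^ (p - 1) := by
  have hp₀ : 0 < p := by linarith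
  have hp₁ : 0 < p - 1 := by linarith
  set G := ∫ a, |v a| ^ p ∂μ
  set J := ∫ a, w a ^ (p / (p - 1)) ∂μ
  have hG : 0 ≤ G := integral_nonneg fun a => Real.rpow_nonneg (abs_nonneg _) _
  have hJ : 0 ≤ J := integral_nonneg_of_ae (hw₀.mono fun a ha => Real.rpow_nonneg ha _)
  have hHoelder : ∫ a, v a * w a ∂μ ≤ G ^ (1 / p) * J ^ (1 / (p / (p - 1))) := by
    calc ∫ a, v a * w a ∂μ ≤ ∫ a, |v a * w a| ∂μ :=
          (le_abs_self _).trans abs_integral_le_integral_abs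
      _ = ∫ a, |v a| * w a ∂μ := integral_congr_ae <| hw₀.mono fun a ha => by
          simp only [abs_mul, abs_of_nonneg (show 0 ≤ w a from ha)]
      _ ≤ G ^ (1 / p) * J ^ (1 / (p / (p - 1))) :=
          integral_mul_le_Lp_mul_Lq_of_nonneg (Real.HolderConjugate.conjExponent hp)
            (.of_forall fun a => abs_nonneg (v a)) hw₀ hv.abs hw
  calc (∫ a, v a * w a ∂μ) ^ p ≤ (G ^ (1 / p) * J ^ (1 / (p / (p - 1)))) ^ p := by gcongr
    _ = G * J ^ (p - 1) := by
      rw [Real.mul_rpow (by positivity) (by positivity), ← Real.rpow_mul hG, ← Real.rpow_mul hJ,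
        one_div_mul_cancel hp₀.ne', Real.rpow_one]
      congr 2
      field_simp

theorem rpow_mul_rpow_neg_le_integral_rpow {s : Set α} {J X : ℝ} (hp : 1 < p)
    (hv : AEStronglyMeasurable v μ) (hvp : Integrable (fun a => |v a| ^ p) μ)
    (hvs : ∀ᵐ a ∂μ, a ∉ s → v a = 0)
    (hw : MemLp w (ENNReal.ofReal (p / (p - 1))) (μ.restrict s)) (hw₀ : ∀ a, 0 ≤ w a)
    (hJ : 0 < J) (hwJ : ∫ a in s, w a ^ (p / (p - 1)) ∂μ ≤ J) (hX : 0 ≤ X)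
    (hXvw : X ≤ ∫ a, v a * w a ∂μ) :
    X ^ p * J ^ (-(p - 1)) ≤ ∫ a, |v a| ^ p ∂μ := by
  have hp₀ : 0 < p := by linarith
  have hvL : MemLp v (ENNReal.ofReal p) μ := by
    rw [← integrable_norm_rpow_iff hv (by simpa using hp₀) ENNReal.ofReal_ne_top,
      ENNReal.toReal_ofReal hp₀.le]
    exact hvp
  have hvw : ∫ a in s, v a * w a ∂μ = ∫ a, v a * w a ∂μ :=
    setIntegral_eq_integral_of_ae_compl_eq_zero <| hvs.mono fun a ha has => by simp [ha has]
  have hvG : ∫ a in s, |v a| ^ p ∂μ = ∫ a, |v a| ^ p ∂μ :=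
    setIntegral_eq_integral_of_ae_compl_eq_zero <| hvs.mono fun a ha has => by
      simp [ha has, hp₀.ne']
  have hHoelder := integral_mul_rpow_le hp (hvL.restrict s) hw (.of_forall hw₀)
    (hvw ▸ hX.trans hXvw)
  rw [hvw, hvG] at hHoelder
  rw [Real.rpow_neg hJ.le, ← div_eq_mul_inv, div_le_iff₀ (by positivity)]
  calc X ^ p ≤ (∫ a, v a * w a ∂μ) ^ p := by gcongr
    _ ≤ _ := hHoelder
    _ ≤ _ := by
      have : 0 ≤ ∫ a in s, w a ^ (p / (p - 1)) ∂μ :=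
        integral_nonneg fun a => Real.rpow_nonneg (hw₀ a) _
      gcongr

end Hoelder

section SphereMoments

variable {n : ℕ}

local notation "𝔼" => EuclideanSpace ℝ (Fin n)

theorem integrable_mul_exp_inner {r : ℝ} {v : 𝔼 → ℝ} (hv : MemLp v 2)
    (hv₀ : ∀ᵐ x, r < ‖x‖ → v x = 0) (ξ : 𝔼) :
    Integrable fun x => v x * Real.exp (inner ℝ ξ x) := by
  refine (hv.integrable_mul (memLp_indicator_exp_inner r ξ 2)).congr ?_
  filter_upwards [hv₀] with x hx
  rcases le_or_gt ‖x‖ r with h | h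
  · simp [h]
  · simp [hx h]

theorem integrable_sphere_prod_mul_exp_inner {r : ℝ} {v : 𝔼 → ℝ} (hv : MemLp v 2)
    (hv₀ : ∀ᵐ x, r < ‖x‖ → v x = 0) :
    Integrable (fun z : Metric.sphere (0 : 𝔼) 1 × 𝔼 => v z.2 * Real.exp (inner ℝ (z.1 : 𝔼) z.2))
      ((volume : Measure 𝔼).toSphere.prod volume) := by
  have hvi : Integrable v := by simpa using integrable_mul_exp_inner hv hv₀ 0
  refine ((hvi.comp_snd _).norm.mul_const (Real.exp r)).mono' ?_ ?_
  · exact hv.1.comp_snd.mul (by fun_prop : Continuous fun z : Metric.sphere (0 : 𝔼) 1 × 𝔼 =>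
      Real.exp (inner ℝ (z.1 : 𝔼) z.2)).aestronglyMeasurable
  · filter_upwards [Measure.quasiMeasurePreserving_snd.ae hv₀] with z hz
    rcases le_or_gt ‖z.2‖ r with h | h
    · rw [norm_mul, Real.norm_eq_abs (Real.exp _), Real.abs_exp]
      gcongr
      refine (real_inner_le_norm _ _).trans ?_
      rwa [norm_eq_of_mem_sphere, one_mul]
    · simp [hz h]

theorem integrable_expMoment_sphere {r : ℝ} {v : 𝔼 → ℝ} (hv : MemLp v 2)
    (hv₀ : ∀ᵐ x, r < ‖x‖ → v x = 0) :
    Integrable (fun e : Metric.sphere (0 : 𝔼) 1 => expMoment (e : 𝔼) v)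
      (volume : Measure 𝔼).toSphere :=
  (integrable_sphere_prod_mul_exp_inner hv hv₀).integral_prod_left

theorem integral_expMoment_sphere {r : ℝ} {v : 𝔼 → ℝ} (hv : MemLp v 2)
    (hv₀ : ∀ᵐ x, r < ‖x‖ → v x = 0) :
    ∫ e : Metric.sphere (0 : 𝔼) 1, expMoment (e : 𝔼) v ∂(volume : Measure 𝔼).toSphere
      = ∫ x, v x * sphereExp x := by
  simp only [expMoment, sphereExp, ← integral_const_mul]
  exact integral_integral_swap (integrable_sphere_prod_mul_exp_inner hv hv₀)

end SphereMoments

section InitialData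

theorem quarter_exp_le_sinh {t : ℝ} (ht : 1 ≤ t) : Real.exp t / 4 ≤ Real.sinh t := by
  have h₁ : 2 ≤ Real.exp t := by linarith [Real.add_one_le_exp t]
  have h₂ : Real.exp (-t) ≤ 1 := Real.exp_le_one_iff.2 (by linarith)
  rw [Real.sinh_eq]
  linarith

theorem memLp_exp_neg_norm {E : Type*} [NormedAddCommGroup E] [NormedSpace ℝ E]
    [FiniteDimensional ℝ E] [MeasurableSpace E] [BorelSpace E] (μ : Measure E)
    [μ.IsAddHaarMeasure] : MemLp (fun x : E => Real.exp (-‖x‖)) 2 μ := by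
  rw [memLp_two_iff_integrable_sq (by fun_prop)]
  have hd : (Module.finrank ℝ E : ℝ) < Module.finrank ℝ E + 1 := by linarith
  refine ((integrable_one_add_norm (μ := μ) hd).const_mul
    ((2 * ((Module.finrank ℝ E + 1 : ℝ) + 1)) ^ (Module.finrank ℝ E + 1 : ℝ))).mono'
    (by fun_prop) (.of_forall fun x => ?_)
  have hx := one_add_rpow_le_exp (a := Module.finrank ℝ E + 1) (by positivity) (norm_nonneg x)
  rw [Real.norm_of_nonneg (by positivity), Real.rpow_neg (by positivity), ← div_eq_mul_inv,
    le_div_iff₀ (by positivity), ← Real.exp_nat_mul]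
  calc Real.exp ((2 : ℕ) * -‖x‖) * (1 + ‖x‖) ^ (Module.finrank ℝ E + 1 : ℝ)
      ≤ Real.exp (-(‖x‖ / 2)) * _ := by
        gcongr
        push_cast
        linarith [norm_nonneg x]
    _ ≤ Real.exp (-(‖x‖ / 2)) * (_ * Real.exp (‖x‖ / 2)) := by gcongr
    _ = _ := by rw [mul_left_comm, ← Real.exp_add, neg_add_cancel, Real.exp_zero, mul_one]

theorem integral_mul_exp_neg_norm_pos {E : Type*} [NormedAddCommGroup E] [NormedSpace ℝ E]
    [FiniteDimensional ℝ E] [MeasurableSpace E] [BorelSpace E] {μ : Measure E}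
    [μ.IsAddHaarMeasure] {g : E → ℝ} (hg : MemLp g 2 μ) (hg_nonneg : ∀ᵐ x ∂μ, 0 ≤ g x)
    (hg_ne : ¬ ∀ᵐ x ∂μ, g x = 0) : 0 < ∫ x, g x * Real.exp (-‖x‖) ∂μ := by
  have h₀ : 0 ≤ᵐ[μ] fun x => g x * Real.exp (-‖x‖) :=
    hg_nonneg.mono fun x hx => mul_nonneg hx (Real.exp_pos _).le
  refine (integral_nonneg_of_ae h₀).lt_of_ne fun h => hg_ne ?_
  filter_upwards [(integral_eq_zero_iff_of_nonneg_ae h₀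
    (hg.integrable_mul (memLp_exp_neg_norm μ))).1 h.symm] with x hx
  exact (mul_eq_zero.1 hx).resolve_right (Real.exp_pos _).ne'

variable {n : ℕ} {p R ε T : ℝ}

local notation "𝔼" => EuclideanSpace ℝ (Fin n)

variable {f g : EuclideanSpace ℝ (Fin n) → ℝ} {u ut : ℝ → EuclideanSpace ℝ (Fin n) → ℝ}

theorem expMoment_nonneg {v : 𝔼 → ℝ} (hv : ∀ᵐ x, 0 ≤ v x) (ξ : 𝔼) : 0 ≤ expMoment ξ v :=
  integral_nonneg_of_ae <| hv.mono fun _ hx => mul_nonneg hx (Real.exp_pos _).le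

theorem expMoment_rpow_nonneg (v : 𝔼 → ℝ) (ξ : 𝔼) : 0 ≤ expMoment ξ fun x => |v x| ^ p :=
  expMoment_nonneg (.of_forall fun _ => Real.rpow_nonneg (abs_nonneg _) _) ξ

namespace IsSolution

theorem expMoment_zero_nonneg (h : IsSolution p f g R ε T u ut) (hε : 0 ≤ ε)
    (hf : ∀ᵐ x, 0 ≤ f x) (ξ : 𝔼) : 0 ≤ expMoment ξ (u 0) := by
  refine expMoment_nonneg ?_ ξ
  filter_upwards [h.initial_u, hf] with x hx hfx
  exact hx ▸ mul_nonneg hε hfx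

theorem mul_integral_exp_neg_norm_le_expMoment_ut (h : IsSolution p f g R ε T u ut) (hT : 0 < T)
    (hε : 0 ≤ ε) (hg : ∀ᵐ x, 0 ≤ g x) {ξ : 𝔼} (hξ : ‖ξ‖ ≤ 1) :
    ε * ∫ x, g x * Real.exp (-‖x‖) ≤ expMoment ξ (ut 0) := by
  have h₀ : (0 : ℝ) ∈ Ico 0 T := ⟨le_rfl, hT⟩
  have hut : ∀ᵐ x, 0 ≤ ut 0 x := by
    filter_upwards [h.initial_ut, hg] with x hx hgx
    exact hx ▸ mul_nonneg hε hgx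
  calc ε * ∫ x, g x * Real.exp (-‖x‖) = ∫ x, ut 0 x * Real.exp (-‖x‖) := by
        rw [← integral_const_mul]
        refine integral_congr_ae (h.initial_ut.mono fun x hx => ?_)
        simp only [hx, mul_assoc]
    _ ≤ ∫ x, ut 0 x * Real.exp (inner ℝ ξ x) := by
        refine integral_mono_of_nonneg (hut.mono fun x hx => mul_nonneg hx (Real.exp_pos _).le)
          (integrable_mul_exp_inner (h.continuous_ut.1 0 h₀) (h.ae_eq_zero_ut 0 h₀) ξ)
          (hut.mono fun x hx => mul_le_mul_of_nonneg_left (Real.exp_le_exp.2 ?_) hx)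
        calc -‖x‖ ≤ -(‖ξ‖ * ‖x‖) :=
              neg_le_neg (mul_le_of_le_one_left (norm_nonneg x) hξ)
          _ ≤ inner ℝ ξ x := neg_le_of_abs_le (abs_real_inner_le_norm ξ x)

theorem cosh_add_sinh_le_expMoment (h : IsSolution p f g R ε T u ut) (hp : p ≠ 0) {ξ : 𝔼}
    (hξ : ‖ξ‖ = 1) {t : ℝ} (ht : t ∈ Ioo 0 T) :
    expMoment ξ (u 0) * Real.cosh t + expMoment ξ (ut 0) * Real.sinh t ≤ expMoment ξ (u t) := by
  have h₀ : (0 : ℝ) ∈ Ico 0 T := ⟨le_rfl, ht.1.trans ht.2⟩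
  have hnhds : 𝓝[>] (0 : ℝ) ≤ 𝓝[Ico 0 T] 0 :=
    (nhdsWithin_Ioo_eq_nhdsGT (ht.1.trans ht.2)).ge.trans (nhdsWithin_mono 0 Ioo_subset_Ico_self)
  have hlim : Tendsto (fun s => expMoment ξ (u s) * Real.cosh (t - s) +
      expMoment ξ (ut s) * Real.sinh (t - s)) (𝓝[>] 0)
      (𝓝 (expMoment ξ (u 0) * Real.cosh (t - 0) + expMoment ξ (ut 0) * Real.sinh (t - 0))) :=
    (((h.continuousOn_expMoment ξ 0 h₀).mul (by fun_prop)).add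
      ((h.continuousOn_expMoment_ut ξ 0 h₀).mul (by fun_prop))).mono_left hnhds
  rw [sub_zero] at hlim
  refine le_of_tendsto hlim ?_
  filter_upwards [Ioo_mem_nhdsGT ht.1] with s hs
  refine (h.isSecondPrimitive_expMoment hp ξ).cosh_add_sinh_le ⟨hs.1, hs.2.trans ht.2⟩ ht hs.2.le
    (.of_forall fun r _ => ?_)
  simpa only [hξ, one_pow, one_mul, le_add_iff_nonneg_left] using expMoment_rpow_nonneg (u r) ξ

theorem mul_exp_le_expMoment (h : IsSolution p f g R ε T u ut) (hp : p ≠ 0) (hε : 0 ≤ ε)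
    (hf : ∀ᵐ x, 0 ≤ f x) (hg : ∀ᵐ x, 0 ≤ g x) {ξ : 𝔼} (hξ : ‖ξ‖ = 1) {t : ℝ} (ht : t ∈ Ico 1 T) :
    ε * (∫ x, g x * Real.exp (-‖x‖)) * (Real.exp t / 4) ≤ expMoment ξ (u t) := by
  have hT : 0 < T := by linarith [ht.1, ht.2]
  have hmass : 0 ≤ ∫ x, g x * Real.exp (-‖x‖) :=
    integral_nonneg_of_ae (hg.mono fun x hx => mul_nonneg hx (Real.exp_pos _).le)
  have hut := h.mul_integral_exp_neg_norm_le_expMoment_ut hT hε hg hξ.le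
  calc ε * (∫ x, g x * Real.exp (-‖x‖)) * (Real.exp t / 4)
      ≤ expMoment ξ (ut 0) * Real.sinh t :=
        mul_le_mul hut (quarter_exp_le_sinh ht.1) (by positivity)
          ((mul_nonneg hε hmass).trans hut)
    _ ≤ expMoment ξ (u 0) * Real.cosh t + expMoment ξ (ut 0) * Real.sinh t :=
        le_add_of_nonneg_left
          (mul_nonneg (h.expMoment_zero_nonneg hε hf ξ) (Real.cosh_pos t).le)
    _ ≤ expMoment ξ (u t) :=
        h.cosh_add_sinh_le_expMoment hp hξ ⟨by linarith [ht.1], ht.2⟩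

theorem isSecondPrimitive_integral (h : IsSolution p f g R ε T u ut) (hp : p ≠ 0) :
    IsSecondPrimitive 0 T (fun t => ∫ x, u t x) (fun t => ∫ x, ut t x)
      fun t => ∫ x, |u t x| ^ p := by
  simpa [expMoment] using h.isSecondPrimitive_expMoment hp 0

theorem integral_ut_nonneg (h : IsSolution p f g R ε T u ut) (hp : p ≠ 0) (hε : 0 ≤ ε)
    (hg : ∀ᵐ x, 0 ≤ g x) {t : ℝ} (ht : t ∈ Ioo 0 T) : 0 ≤ ∫ x, ut t x := by
  have hT : 0 < T := ht.1.trans ht.2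
  have h₀ : 0 ≤ ∫ x, ut 0 x := by
    refine integral_nonneg_of_ae ?_
    filter_upwards [h.initial_ut, hg] with x hx hgx
    exact hx ▸ mul_nonneg hε hgx
  have hcont : ContinuousOn (fun s => ∫ x, ut s x) (Ico 0 T) := by
    simpa [expMoment] using h.continuousOn_expMoment_ut 0
  have hnhds : 𝓝[>] (0 : ℝ) ≤ 𝓝[Ico 0 T] 0 :=
    (nhdsWithin_Ioo_eq_nhdsGT hT).ge.trans (nhdsWithin_mono 0 Ioo_subset_Ico_self)
  refine h₀.trans (le_of_tendsto ((hcont 0 ⟨le_rfl, hT⟩).mono_left hnhds) ?_)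
  filter_upwards [Ioo_mem_nhdsGT ht.1] with s hs
  exact (h.isSecondPrimitive_integral hp).deriv_mono ⟨hs.1, hs.2.trans ht.2⟩ ht hs.2.le
    (.of_forall fun r _ => integral_nonneg fun x => Real.rpow_nonneg (abs_nonneg _) _)

theorem integral_u_nonneg (h : IsSolution p f g R ε T u ut) (hp : p ≠ 0) (hε : 0 ≤ ε)
    (hf : ∀ᵐ x, 0 ≤ f x) (hg : ∀ᵐ x, 0 ≤ g x) {t : ℝ} (ht : t ∈ Ico 0 T) :
    0 ≤ ∫ x, u t x := by
  have h₀ : 0 ≤ ∫ x, u 0 x := by simpa [expMoment] using h.expMoment_zero_nonneg hε hf 0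
  have hcont : ContinuousOn (fun s => ∫ x, u s x) (Ico 0 T) := by
    simpa [expMoment] using h.continuousOn_expMoment 0
  have hmono : MonotoneOn (fun s => ∫ x, u s x) (Ico 0 T) := by
    refine monotoneOn_of_hasDerivWithinAt_nonneg (f' := fun s => ∫ x, ut s x) (convex_Ico 0 T)
      hcont (fun s hs => ?_) fun s hs => ?_ <;> rw [interior_Ico] at *
    · exact ((h.isSecondPrimitive_integral hp).hasDerivAt s hs).hasDerivWithinAt
    · exact h.integral_ut_nonneg hp hε hg hs
  exact h₀.trans (hmono ⟨le_rfl, ht.1.trans_lt ht.2⟩ ht ht.1)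

end IsSolution

end InitialData

section LowerBounds

variable {n : ℕ} {p R : ℝ}

local notation "𝔼" => EuclideanSpace ℝ (Fin n)

theorem IsSolution.rpow_mul_rpow_neg_le_integral_rpow {f g : 𝔼 → ℝ} {u ut : ℝ → 𝔼 → ℝ}
    {ε T t : ℝ} (h : IsSolution p f g R ε T u ut) (hp : 1 < p) (ht : t ∈ Ico 0 T)
    (hint : Integrable fun x => |u t x| ^ p) {w : 𝔼 → ℝ} (hw : Continuous w) (hw₀ : ∀ x, 0 ≤ w x)
    {J X : ℝ} (hJ : 0 < J)
    (hwJ : ∫ x in Metric.closedBall 0 (t + R), w x ^ (p / (p - 1)) ≤ J) (hX : 0 ≤ X)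
    (hXuw : X ≤ ∫ x, u t x * w x) :
    X ^ p * J ^ (-(p - 1)) ≤ ∫ x, |u t x| ^ p := by
  have hball := isCompact_closedBall (0 : 𝔼) (t + R)
  have : IsFiniteMeasure (volume.restrict (Metric.closedBall (0 : 𝔼) (t + R))) :=
    ⟨by simpa using hball.measure_lt_top⟩
  obtain ⟨M, hM⟩ := hball.exists_bound_of_continuousOn hw.continuousOn
  refine SemilinearWave.rpow_mul_rpow_neg_le_integral_rpow hp (h.continuous_u.1.1 t ht).1 hint
    ?_ (.of_bound hw.aestronglyMeasurable M
      ((ae_restrict_iff' hball.measurableSet).2 (.of_forall hM))) hw₀ hJ hwJ hX hXuw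
  filter_upwards [h.support_u t ht] with x hx hmem
  exact hx (by simpa using hmem)

theorem IsSolution.le_integral_mul_sphereExp {f g : EuclideanSpace ℝ (Fin n) → ℝ}
    {u ut : ℝ → EuclideanSpace ℝ (Fin n) → ℝ} {ε T t : ℝ} (h : IsSolution p f g R ε T u ut)
    (hp : p ≠ 0) (hε : 0 ≤ ε) (hf : ∀ᵐ x, 0 ≤ f x) (hg : ∀ᵐ x, 0 ≤ g x) (ht : t ∈ Ico 1 T) :
    ε * ((∫ x, g x * Real.exp (-‖x‖)) / 4 * (volume : Measure 𝔼).toSphere.real univ) ≤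
      ∫ x, u t x * (Real.exp (-t) * sphereExp x) := by
  have ht₀ : t ∈ Ico 0 T := ⟨by linarith [ht.1], ht.2⟩
  have hu : MemLp (u t) 2 := h.continuous_u.1.1 t ht₀
  calc ε * ((∫ x, g x * Real.exp (-‖x‖)) / 4 * (volume : Measure 𝔼).toSphere.real univ)
      = Real.exp (-t) * ∫ _ : Metric.sphere (0 : 𝔼) 1,
        ε * (∫ x, g x * Real.exp (-‖x‖)) * (Real.exp t / 4) ∂(volume : Measure 𝔼).toSphere := by
        rw [integral_const, smul_eq_mul, Real.exp_neg]
        field_simp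
    _ ≤ Real.exp (-t) * ∫ e : Metric.sphere (0 : 𝔼) 1, expMoment (e : 𝔼) (u t)
        ∂(volume : Measure 𝔼).toSphere := by
        refine mul_le_mul_of_nonneg_left (integral_mono (integrable_const _)
          (integrable_expMoment_sphere hu (h.support_u t ht₀)) fun e => ?_) (Real.exp_pos _).le
        exact h.mul_exp_le_expMoment hp hε hf hg (norm_eq_of_mem_sphere e) ht
    _ = ∫ x, u t x * (Real.exp (-t) * sphereExp x) := by
        rw [integral_expMoment_sphere hu (h.support_u t ht₀), ← integral_const_mul]
        simp only [mul_left_comm]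

theorem exists_le_integral_rpow_of_initial_ut [NeZero n] (hp : 1 < p) (hR : 1 ≤ R) {g : 𝔼 → ℝ}
    (hg : ∀ᵐ x, 0 ≤ g x) (hmass : 0 < ∫ x, g x * Real.exp (-‖x‖)) :
    ∃ c > 0, ∀ (f : 𝔼 → ℝ) (ε T : ℝ) (u ut : ℝ → 𝔼 → ℝ), (∀ᵐ x, 0 ≤ f x) → 0 < ε →
      IsSolution p f g R ε T u ut → ∀ᵐ t, t ∈ Ico 1 T →
        c * ε ^ p * (1 + t) ^ (((n : ℝ) - 1) * (1 - p / 2)) ≤ ∫ x, |u t x| ^ p := by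
  have hp₁ : 0 < p - 1 := by linarith
  obtain ⟨C, hC, hCI⟩ := exists_integral_sphereExp_rpow_le (E := 𝔼) (q := p / (p - 1))
    (by positivity) hR
  rw [finrank_euclideanSpace_fin] at hCI
  set σ := (volume : Measure 𝔼).toSphere.real univ with hσ
  have hσ₀ : 0 < σ := by
    rw [hσ, Measure.toSphere_real_apply_univ]
    exact mul_pos (Nat.cast_pos.2 Module.finrank_pos) (ENNReal.toReal_pos
      (Metric.measure_ball_pos volume _ one_pos).ne' measure_ball_lt_top.ne)
  set a := (∫ x, g x * Real.exp (-‖x‖)) / 4 * σ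
  have ha₀ : 0 < a := by positivity
  refine ⟨a ^ p * C ^ (-(p - 1)), by positivity, fun f ε T u ut hf hε h => ?_⟩
  filter_upwards [h.ae_integrable_rpow (by linarith)] with t hint ht
  have ht₀ : t ∈ Ico 0 T := ⟨by linarith [ht.1], ht.2⟩
  refine le_of_eq_of_le ?_ (h.rpow_mul_rpow_neg_le_integral_rpow hp ht₀
    (hint ⟨by linarith [ht.1], ht.2⟩) (continuous_const.mul continuous_sphereExp)
    (fun x => mul_nonneg (Real.exp_pos _).le (sphereExp_nonneg x))
    (J := C * (1 + t) ^ (((n : ℝ) - 1) * (1 - p / (p - 1) / 2)))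
    (mul_pos hC (Real.rpow_pos_of_pos (by linarith [ht.1]) _)) (hCI t ht₀.1)
    (by positivity)
    (h.le_integral_mul_sphereExp (by linarith) hε.le hf hg ht))
  have ht₁ : 0 < 1 + t := by linarith [ht.1]
  rw [Real.mul_rpow hε.le ha₀.le, Real.mul_rpow hC.le (by positivity), ← Real.rpow_mul ht₁.le,
    show ((n : ℝ) - 1) * (1 - p / (p - 1) / 2) * -(p - 1) = ((n : ℝ) - 1) * (1 - p / 2) by
      field_simp; ring]
  ring

theorem exists_mul_integral_rpow_le_integral_rpow (hp : 1 < p) (hR : 0 ≤ R) :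
    ∃ c > 0, ∀ (f g : 𝔼 → ℝ) (ε T : ℝ) (u ut : ℝ → 𝔼 → ℝ), IsSolution p f g R ε T u ut →
      (∀ t ∈ Ioo 0 T, 0 ≤ ∫ x, u t x) → ∀ᵐ t, t ∈ Ioo 0 T →
        c * (t + R) ^ (-(n * (p - 1))) * (∫ x, u t x) ^ p ≤ ∫ x, |u t x| ^ p := by
  set V : ℝ := volume.real (Metric.ball (0 : 𝔼) 1) with hV
  have hV₀ : 0 < V :=
    ENNReal.toReal_pos (Metric.measure_ball_pos volume _ one_pos).ne' measure_ball_lt_top.ne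
  refine ⟨V ^ (-(p - 1)), by positivity, fun f g ε T u ut h hU => ?_⟩
  filter_upwards [h.ae_integrable_rpow (by linarith)] with t hint ht
  have hr : 0 < t + R := by linarith [ht.1]
  have hvol : ∫ _ in Metric.closedBall (0 : 𝔼) (t + R), (1 : ℝ) ^ (p / (p - 1))
      = (t + R) ^ n * V := by
    rw [setIntegral_const, Real.one_rpow, smul_eq_mul, mul_one, measureReal_def,
      Measure.addHaar_closedBall _ _ hr.le, ENNReal.toReal_mul,
      ENNReal.toReal_ofReal (by positivity), finrank_euclideanSpace_fin, hV, measureReal_def]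
  refine le_of_eq_of_le ?_ (h.rpow_mul_rpow_neg_le_integral_rpow hp (Ioo_subset_Ico_self ht)
    (hint ht) continuous_const (fun _ => zero_le_one) (by positivity) hvol.le (hU t ht)
    (by simp))
  rw [Real.mul_rpow (by positivity) hV₀.le, ← Real.rpow_natCast, ← Real.rpow_mul hr.le,
    mul_neg]
  ring

end LowerBounds

section Lifespan

variable {n : ℕ} {p R ε T : ℝ} {f g : EuclideanSpace ℝ (Fin n) → ℝ}
  {u ut : ℝ → EuclideanSpace ℝ (Fin n) → ℝ}

theorem gammaExponent_pos (hn : 2 ≤ n) (hp₁ : 1 < p) (hp₂ : p < straussExponent n) :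
    0 < gammaExponent p n := by
  have hn' : (2 : ℝ) ≤ n := by exact_mod_cast hn
  rw [straussExponent, lt_div_iff₀ (by linarith)] at hp₂
  set D : ℝ := (n : ℝ) ^ 2 + 10 * (n : ℝ) - 7 with hD
  have hD₁ : 1 ≤ D := by rw [hD]; nlinarith
  have hs : √D ^ 2 = D := Real.sq_sqrt (by linarith)
  have hs₁ : 1 ≤ √D := Real.one_le_sqrt.2 hD₁
  have hlower : 2 * ((n : ℝ) - 1) < p * (2 * ((n : ℝ) - 1)) := by nlinarith
  have hsq : (p * (2 * ((n : ℝ) - 1)) - (n + 1)) ^ 2 < √D ^ 2 :=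
    sq_lt_sq' (by linarith) (by linarith)
  have hγ : 4 * ((n : ℝ) - 1) * gammaExponent p n
      = D - (p * (2 * ((n : ℝ) - 1)) - (n + 1)) ^ 2 := by
    rw [gammaExponent, hD]
    ring
  exact pos_of_mul_pos_right (by linarith : 0 < 4 * ((n : ℝ) - 1) * gammaExponent p n)
    (by linarith)

theorem IsSolution.mono_radius (h : IsSolution p f g R ε T u ut) {R' : ℝ} (hR : R ≤ R') :
    IsSolution p f g R' ε T u ut :=
  { h with
    support_u := fun t ht => (h.support_u t ht).mono fun x hx h' => hx (by linarith)
    support_ut := fun t ht => (h.support_ut t ht).mono fun x hx h' => hx (by linarith) }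

theorem exists_rpow_mul_rpow_le_of_isSolution [NeZero n] (hp : 1 < p) (hg : MemLp g 2)
    (hf_nonneg : ∀ᵐ x, 0 ≤ f x) (hg_nonneg : ∀ᵐ x, 0 ≤ g x) (hg_ne : ¬ ∀ᵐ x, g x = 0) (R : ℝ) :
    ∃ K : ℝ, ∀ (ε T T₀ : ℝ) (u ut : ℝ → EuclideanSpace ℝ (Fin n) → ℝ), 0 < ε → 1 ≤ T₀ →
      4 * T₀ ≤ T → IsSolution p f g R ε T u ut →
      ε ^ (p * (p - 1)) * T₀ ^ (gammaExponent p n / 2) ≤ K := by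
  have hp₀ : p ≠ 0 := by linarith
  have hR : 1 ≤ max R 1 := le_max_right R 1
  obtain ⟨c₁, hc₁, hdata⟩ := exists_le_integral_rpow_of_initial_ut hp hR hg_nonneg
    (integral_mul_exp_neg_norm_pos hg hg_nonneg hg_ne)
  obtain ⟨c₂, hc₂, hmean⟩ := exists_mul_integral_rpow_le_integral_rpow (n := n) hp
    (zero_le_one.trans hR)
  obtain ⟨K, hK⟩ := exists_kato_constant (β := ((n : ℝ) - 1) * (1 - p / 2)) (ν := n * (p - 1)) hp
    (mul_nonneg n.cast_nonneg (by linarith)) (zero_le_one.trans hR) hc₁ hc₂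
  refine ⟨K, fun ε T T₀ u ut hε hT₀ hT h => ?_⟩
  replace h := h.mono_radius (le_max_left R 1)
  have hU : ∀ t ∈ Ioo 0 T, 0 ≤ ∫ x, u t x := fun t ht =>
    h.integral_u_nonneg hp₀ hε.le hf_nonneg hg_nonneg (Ioo_subset_Ico_self ht)
  have hkato := hK (ε ^ p) T T₀ _ _ _ (by positivity) hT₀ hT (h.isSecondPrimitive_integral hp₀)
    (fun t ht => h.integral_ut_nonneg hp₀ hε.le hg_nonneg ht) hU
    (hdata f ε T u ut hf_nonneg hε h)
    ((hmean f g ε T u ut h hU).mono fun t hG ht => hG ⟨by linarith [ht.1], ht.2⟩)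
  rw [← Real.rpow_mul hε.le] at hkato
  refine le_of_eq_of_le ?_ hkato
  rw [gammaExponent]
  ring_nf

theorem lifespan_le {B : ℝ} (hB : ∀ T u ut, IsSolution p f g R ε T u ut → T ≤ B) :
    lifespan p f g R ε ≤ ENNReal.ofReal B :=
  iSup₂_le fun _ ⟨_, _, _, h⟩ => ENNReal.ofReal_le_ofReal (hB _ _ _ h)

theorem lt_mul_rpow_mul_rpow {K a γ ε : ℝ} (hK : 0 < K) (hγ : 0 < γ) (hε : 0 < ε) :
    K < ε ^ a * (max 1 ((2 * K) ^ (2 / γ)) * ε ^ (-(2 * a / γ))) ^ (γ / 2) := by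
  have hscale : (ε ^ (-(2 * a / γ))) ^ (γ / 2) = (ε ^ a)⁻¹ := by
    rw [← Real.rpow_mul hε.le, ← Real.rpow_neg hε.le]
    congr 1
    field_simp
  have hM : 2 * K ≤ max 1 ((2 * K) ^ (2 / γ)) ^ (γ / 2) := by
    calc 2 * K = ((2 * K) ^ (2 / γ)) ^ (γ / 2) := by
          rw [← Real.rpow_mul (by positivity), div_mul_div_cancel₀ hγ.ne', div_self two_ne_zero,
            Real.rpow_one]
      _ ≤ _ := by gcongr; exact le_max_right _ _
  rw [Real.mul_rpow (by positivity) (by positivity), hscale, mul_left_comm,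
    mul_inv_cancel₀ (by positivity), mul_one]
  linarith

end Lifespan

end SemilinearWave

open SemilinearWave in
theorem theorem3p1_general (n : ℕ) (hn : 1 ≤ n) (p : ℝ) (hp : 1 < p)
    (hγ : 0 < gammaExponent p n) (f g : EuclideanSpace ℝ (Fin n) → ℝ) (hg : MemLp g 2)
    (hf_nonneg : ∀ᵐ x, 0 ≤ f x) (hg_nonneg : ∀ᵐ x, 0 ≤ g x) (hg_ne : ¬ ∀ᵐ x, g x = 0) (R : ℝ) :
    ∃ C : ℝ, 0 < C ∧ ∀ ε : ℝ, 0 < ε → ε ≤ 1 →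
      lifespan p f g R ε ≤
        ENNReal.ofReal (C * ε ^ (-(2 * p * (p - 1) / gammaExponent p n))) := by
  have : NeZero n := ⟨by omega⟩
  obtain ⟨K₀, hK₀⟩ := exists_rpow_mul_rpow_le_of_isSolution hp hg hf_nonneg hg_nonneg hg_ne R
  set γ := gammaExponent p n
  set K := max 1 K₀
  set M := max 1 ((2 * K) ^ (2 / γ))
  refine ⟨4 * M, by positivity, fun ε hε hε₁ => lifespan_le fun T u ut h => ?_⟩
  set T₀ := M * ε ^ (-(2 * (p * (p - 1)) / γ))
  have hT₀ : 1 ≤ T₀ := one_le_mul_of_one_le_of_one_le (le_max_left _ _)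
    (Real.one_le_rpow_of_pos_of_le_one_of_nonpos hε hε₁
      (neg_nonpos.2 (div_nonneg (by nlinarith) hγ.le)))
  have hlt : T < 4 * T₀ := by
    by_contra! hT
    exact ((hK₀ ε T T₀ u ut hε hT₀ hT h).trans (le_max_right 1 K₀)).not_gt
      (lt_mul_rpow_mul_rpow (by positivity) hγ hε)
  calc T ≤ 4 * T₀ := hlt.le
    _ = 4 * M * ε ^ (-(2 * p * (p - 1) / γ)) := by simp only [T₀, mul_assoc]

theorem theorem3p1 (n : ℕ) (hn : 2 ≤ n) (p : ℝ) (hp₁ : 1 < p)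
    (hp₂ : p < SemilinearWave.straussExponent n)
    (f g : EuclideanSpace ℝ (Fin n) → ℝ)
    (hf : SemilinearWave.MemH1 f) (hg : MemLp g 2)
    (hf_nonneg : ∀ᵐ x, 0 ≤ f x) (hg_nonneg : ∀ᵐ x, 0 ≤ g x)
    (hf_supp : ∃ K : Set (EuclideanSpace ℝ (Fin n)), IsCompact K ∧ ∀ᵐ x, x ∉ K → f x = 0)
    (hg_supp : ∃ K : Set (EuclideanSpace ℝ (Fin n)), IsCompact K ∧ ∀ᵐ x, x ∉ K → g x = 0)
    (hg_ne : ¬ ∀ᵐ x, g x = 0) (R : ℝ) :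
    ∃ ε₀ : ℝ, 0 < ε₀ ∧ ∃ C : ℝ, 0 < C ∧ ∀ ε : ℝ, 0 < ε → ε ≤ ε₀ →
      SemilinearWave.lifespan p f g R ε ≤
        ENNReal.ofReal (C * ε ^ (-(2 * p * (p - 1) / SemilinearWave.gammaExponent p n))) :=
  ⟨1, one_pos, theorem3p1_general n (by omega) p hp₁
    (SemilinearWave.gammaExponent_pos hn hp₁ hp₂) f g hg hf_nonneg hg_nonneg hg_ne R⟩
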